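/- Let $\mathcal C_c^b(B)$ be the set of bounded measurable functions $f:\mathbb R^d\to\mathbb R$ whose support is a compact subset of $B\subset\mathbb R^d$. Let $\mathsf M$ be a wide-sense stationary random $L^2$ signed measure on $\mathbb R^d$, i.e. a family of real random variables $I_{\mathsf M}(f)\in L^2(\mathbf P)$, $f\in\mathcal C_c^b(\mathbb R^d)$, which is almost surely linear and $\sigma$-additive (for each $f$ and each sequence of disjoint Borel sets $B_i$, a.s. $\sum_i I_{\mathsf M}(f1_{B_i})=I_{\mathsf M}(f1_{\cup_i B_i})$), with $\mathbf E\,I_{\mathsf M}(f)=\lambda\int f$ for some constant $\lambda\in\mathbb R$ and with $\mathrm{Var}(I_{\mathsf M}(f))$ invariant under translations of $f$. Suppose $\mathsf M$ has spectral measure $\mathsf S$, i.e. the non-negative even measure with $\mathrm{Var}(I_{\mathsf M}(f))=\int_{\mathbb R^d}|\hat f|^2\,d\mathsf S$ for all $f\in\mathcal C_c^b(\mathbb R^d)$, where $\hat f(u)=\int e^{-i\langle u,t\rangle}f(t)\,dt$, and let $\mathsf s:\mathbb R^d\to[0,\infty)$ be its spectral density, i.e. the density of the absolutely continuous part of $\mathsf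 S$. For a bounded measurable set $A$ and $\gamma\in\mathcal C_c^b(\mathbb R^d)$, $\mathsf M$ is linearly $\gamma$-rigid on $A$ if there are $h_n\in\mathcal C_c^b(A^c)$ with $I_{\mathsf M}(h_n)\to I_{\mathsf M}(\gamma)$ a.s. and in $L^2(\mathbf P)$; it is linearly maximally rigid on $A$ if this holds for every $\gamma\in\mathcal C_c^b(\mathbb R^d)$; and for a multi-index $\mathbf k\in\mathbb N^d$ it is linearly $\mathbf k$-rigid on $A$ if it holds for $\gamma(t)=1_A(t)\,t^{\mathbf k}$, where $t^{\mathbf k}=\prod_i t_i^{\mathbf k_i}$. **Theorem 3.8.** Let $R>0$ and suppose that either * $\mathsf s$ is isotropic, i.e. $\mathsf s(u)$ depends only on $\|u\|$, and $A=\{t:\|t\|\le R\}$, or * $\mathsf s$ is separable, i.e. $\mathsf s(u)=\mathsf s_1(u_1)\cdots\mathsf s_d(u_d)$ for some even functions $\mathsf s_i:\mathbb R\to[0,\infty)$, and $A=[-R,R]^d$. Assume that $\mathsf M$ is not linearly maximally rigid on $A$. Let $\mathbf k\in\mathbb N^d$ be such that, for some $\varepsilon>0$, $$\int_{B(0,\varepsilon)}\frac{u^{2\mathbf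 k}}{\mathsf s(u)}\,du<\infty$$ (with the convention $1/0=\infty$). Then for every $\eta>0$, $\mathsf M$ is not linearly $\mathbf k$-rigid on $A^{+\eta}=\bigcup_{t\in A}\{x\in\mathbb R^d:\|x-t\|<\eta\}$. -/

import Mathlib

open MeasureTheory ProbabilityTheory Filter Topology
open scoped ENNReal NNReal

namespace Rigidity

/-- The Euclidean space `ℝ^d`. -/
abbrev E (d : ℕ) : Type := EuclideanSpace ℝ (Fin d)

/-- The class `C_c^b(B)`: measurable bounded real functions on `ℝ^d` whose support is a compact
subset of `B`. -/
structure IsCcb {d : ℕ} (B : Set (E d)) (f : E d → ℝ) : Prop where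
  measurable : Measurable f
  bounded : ∃ C : ℝ, ∀ x, |f x| ≤ C
  hasCompactSupport : HasCompactSupport f
  tsupport_subset : tsupport f ⊆ B

/-- A random `L²` signed measure on `ℝ^d`, given by its linear statistics: a real random variable
`M.I f` in `L²(P)` for each `f ∈ C_c^b(ℝ^d)`, almost surely linear and `σ`-additive.
The values of `M.I` outside of the class `C_c^b(ℝ^d)` play no role. -/
structure RandomMeasure (d : ℕ) {Ω : Type*} [MeasurableSpace Ω] (P : Measure Ω) where
  /-- the linear statistic `∫ f dM` -/
  I : (E d → ℝ) → Ω → ℝ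
  memLp : ∀ f, IsCcb Set.univ f → MemLp (I f) 2 P
  add : ∀ f g, IsCcb Set.univ f → IsCcb Set.univ g → ∀ᵐ ω ∂P, I (f + g) ω = I f ω + I g ω
  smul : ∀ (c : ℝ) (f), IsCcb Set.univ f → ∀ᵐ ω ∂P, I (c • f) ω = c * I f ω
  sigma_additive : ∀ f, IsCcb Set.univ f → ∀ B : ℕ → Set (E d), (∀ n, MeasurableSet (B n)) →
    Pairwise (Function.onFun Disjoint B) →
    ∀ᵐ ω ∂P, Tendsto (fun n : ℕ => ∑ i ∈ Finset.range n, I ((B i).indicator f) ω) atTop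
      (𝓝 (I ((⋃ i, B i).indicator f) ω))

/-- The Fourier transform `u ↦ ∫ e^{-i⟨u,t⟩} f(t) dt`. -/
noncomputable def fourier {d : ℕ} (f : E d → ℝ) (u : E d) : ℂ :=
  ∫ t : E d, Complex.exp (-(Complex.I * ((inner ℝ u t : ℝ) : ℂ))) * (f t : ℂ)

/-- The monomial `t ↦ t^k = ∏ i, t_i ^ k_i`. -/
def monomial {d : ℕ} (k : Fin d → ℕ) (t : E d) : ℝ := ∏ i, t i ^ k i

namespace RandomMeasure

variable {d : ℕ} {Ω : Type*} [MeasurableSpace Ω] {P : Measure Ω}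

/-- Wide-sense stationarity: the mean measure is a multiple of Lebesgue measure (the factor is the
mean intensity), and variances of linear statistics are invariant under translation. -/
structure IsWideSenseStationary (M : RandomMeasure d P) : Prop where
  exists_intensity : ∃ intensity : ℝ, ∀ f, IsCcb Set.univ f →
    ∫ ω, M.I f ω ∂P = intensity * ∫ t, f t
  variance_translate : ∀ f, IsCcb Set.univ f → ∀ x : E d,
    variance (M.I (fun t => f (t - x))) P = variance (M.I f) P

/-- `S` is the spectral measure of `M`: the even measure with `Var (∫ f dM) = ∫ |f̂|² dS` for
all `f ∈ C_c^b(ℝ^d)`. (The evenness makes `S` unique, as `f` is real.) -/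
structure IsSpectralMeasure (M : RandomMeasure d P) (S : Measure (E d)) : Prop where
  even : S.map (fun u => -u) = S
  variance_eq : ∀ f, IsCcb Set.univ f →
    ENNReal.ofReal (variance (M.I f) P) = ∫⁻ u, ‖fourier f u‖ₑ ^ 2 ∂S

/-- `s` is (a version of) the spectral density of `M`: the density, with respect to Lebesgue
measure, of the absolutely continuous part of the spectral measure. -/
def IsSpectralDensity (M : RandomMeasure d P) (s : E d → ℝ≥0) : Prop :=
  Measurable s ∧ ∃ S ν : Measure (E d), M.IsSpectralMeasure S ∧
    Measure.MutuallySingular ν volume ∧ S = volume.withDensity (fun u => (s u : ℝ≥0∞)) + ν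

/-- Linear `γ`-rigidity on `A`: the statistic `∫ γ dM` is the limit, almost surely and in `L²(P)`,
of linear statistics of the restriction of `M` to the complement of `A`. -/
def LinearlyRigid (M : RandomMeasure d P) (γ : E d → ℝ) (A : Set (E d)) : Prop :=
  ∃ h : ℕ → E d → ℝ, (∀ n, IsCcb Aᶜ (h n)) ∧
    (∀ᵐ ω ∂P, Tendsto (fun n => M.I (h n) ω) atTop (𝓝 (M.I γ ω))) ∧
    Tendsto (fun n => eLpNorm (M.I (h n) - M.I γ) 2 P) atTop (𝓝 0)

/-- Maximal linear rigidity on `A`. -/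
def LinearlyMaximallyRigid (M : RandomMeasure d P) (A : Set (E d)) : Prop :=
  ∀ γ, IsCcb Set.univ γ → M.LinearlyRigid γ A

/-- Linear `k`-rigidity on the bounded set `A`, for a multi-index `k`: the `k`-th moment
`∫_A t^k M(dt)` is linearly determined by `M` outside of `A`. -/
def LinearlyRigidOfOrder (M : RandomMeasure d P) (k : Fin d → ℕ) (A : Set (E d)) : Prop :=
  M.LinearlyRigid (A.indicator (monomial k)) A

end RandomMeasure

/-- `s(u)` depends only on `‖u‖`. -/
def IsIsotropic {d : ℕ} (s : E d → ℝ≥0) : Prop := ∀ u v : E d, ‖u‖ = ‖v‖ → s u = s v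

/-- `s(u) = s₁(u₁) ⋯ s_d(u_d)` with even factors. -/
def IsSeparable {d : ℕ} (s : E d → ℝ≥0) : Prop :=
  ∃ σ : Fin d → ℝ → ℝ≥0, (∀ i x, σ i (-x) = σ i x) ∧ ∀ u : E d, s u = ∏ i, σ i (u i)

/-- The cube `[-R, R]^d`. -/
def cube (d : ℕ) (R : ℝ) : Set (E d) := {t | ∀ i, t i ∈ Set.Icc (-R) R}

end Rigidity

/-! Adding to the spectral measure an atom at the origin of mass the squared intensity gives a
measure `N` with `E[I(f)²] = ∫ |f̂|² dN`. The map `I(f) ↦ f̂` is thus isometric into `L²(N)`, and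
linear rigidity becomes an approximation problem there.

If `M` is not maximally rigid on `A`, orthogonality gives `p ∈ L²(N)` which annihilates every `ĥ`
with `h` supported off `A`, but not every `γ̂`. Formally, the inverse Fourier transform of `p N` is
then carried by `-A`. Multiplying by the transform `χ̂` of a mollifier makes this inverse transform
a bounded function with bounded carrier, so `χ̂ p N` is absolutely continuous, with continuous
density `F = s χ̂ p`. This `F` is of exponential type with carrier near `-A`, and `∫ |F|² / s ≤ ∫
|p|² dN < ∞` (`exists_expType_of_not_linearlyMaximallyRigid`).

`F` may vanish at the origin, and the symmetry of `s` serves to remove that zero. If `s` is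
isotropic, averaging over rotations makes `F` radial, and a radial function of exponential type can
be divided by `‖u‖²` as long as it vanishes at `0`, without enlarging the carrying ball. If `s` is
separable, `F` is cut along lines parallel to the axes, each slice is divided by a power of `x`, and
the quotients are multiplied together. The result `H` has `H 0 ≠ 0`, its carrier is inside the
thickened set `D`, and its growth away from the zeros divided out is controlled by functions square
integrable for the weight.

Finally, multiply `H` by `∏ (e^{-i h u_j} - 1)^{k_j}`. Near the origin this factor is `O(|u^k|)`, so
the hypothesis on `u^{2k} / s` makes the product square integrable for `1 / s`. The factor acts as a
mixed finite difference, which sends `t^k` to a non-zero constant. Hence the pairing with `1_D t^k -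
f` has the same non-zero value for all `f` supported off `D`. By Cauchy–Schwarz it is at most a
constant times the `L²` distance of `I(f)` from `I(1_D t^k)`, so this distance cannot tend to `0`
(`RandomMeasure.not_linearlyRigidOfOrder`). -/

namespace Rigidity

/-! ### Fourier transforms of complex measures with bounded carrier. -/

section ExpType

variable {V : Type*} [NormedAddCommGroup V] [InnerProductSpace ℝ V]

/-- The plane wave `e^{-i⟨u,t⟩}`. -/
noncomputable def wave (u t : V) : ℂ :=
  Complex.exp (-(Complex.I * ((inner ℝ u t : ℝ) : ℂ)))

@[simp] lemma norm_wave (u t : V) : ‖wave u t‖ = 1 := by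
  rw [wave, Complex.norm_exp]; simp

@[simp] lemma wave_zero_left (t : V) : wave 0 t = 1 := by simp [wave]

@[simp] lemma wave_zero_right (u : V) : wave u 0 = 1 := by simp [wave]

lemma wave_comm (u t : V) : wave u t = wave t u := by simp [wave, real_inner_comm]

lemma wave_add_right (u t t' : V) : wave u (t + t') = wave u t * wave u t' := by
  rw [wave, wave, wave, ← Complex.exp_add, inner_add_right]; congr 1; push_cast; ring

lemma wave_add_left (u v t : V) : wave (u + v) t = wave u t * wave v t := by
  rw [wave_comm, wave_add_right, wave_comm t, wave_comm t]

lemma wave_neg_right (u t : V) : wave u (-t) = (starRingEnd ℂ) (wave u t) := by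
  rw [wave, wave, ← Complex.exp_conj]; simp

lemma wave_neg_left (u t : V) : wave (-u) t = (starRingEnd ℂ) (wave u t) := by
  rw [wave_comm, wave_neg_right, wave_comm]

lemma wave_smul_left (c : ℝ) (u t : V) : wave (c • u) t = wave u (c • t) := by
  simp [wave, real_inner_smul_left, real_inner_smul_right]

lemma norm_wave_sub_one_le (u t : V) : ‖wave u t - 1‖ ≤ ‖inner ℝ u t‖ := by
  have h : wave u t - 1 = Complex.exp (Complex.I * ((-(inner ℝ u t) : ℝ) : ℂ)) - 1 := by
    simp [wave]
  rw [h, ← norm_neg (inner ℝ u t)]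
  exact Real.norm_exp_I_mul_ofReal_sub_one_le

lemma continuous_wave : Continuous fun p : V × V => wave p.1 p.2 := by
  unfold wave; fun_prop

@[fun_prop]
lemma Continuous.wave {Y : Type*} [TopologicalSpace Y] {f g : Y → V} (hf : Continuous f)
    (hg : Continuous g) : Continuous fun y => wave (f y) (g y) :=
  continuous_wave.comp (hf.prodMk hg)

/-- `F` is the Fourier transform of a complex measure which is carried by `B`; the complex measure
is given as the image under `T` of a bounded density with respect to a finite measure. -/
def HasExpType [MeasurableSpace V] (B : Set V) (F : V → ℂ) : Prop :=
  ∃ (X : Type) (_ : MeasurableSpace X) (μ : Measure X) (T : X → V) (b : X → ℂ),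
    IsFiniteMeasure μ ∧ Measurable T ∧ Measurable b ∧ (∃ C, ∀ x, ‖b x‖ ≤ C) ∧ (∀ x, T x ∈ B) ∧
    ∀ u, F u = ∫ x, wave u (T x) * b x ∂μ

/-- Boundedness of `a` dominates the exponential on a complex unit ball, so one may differentiate
under the integral. This extends the restriction of a Fourier transform to a line to an entire
function. -/
lemma differentiable_integral_exp {X : Type*} [MeasurableSpace X] {μ : Measure X}
    [IsFiniteMeasure μ] {a : X → ℝ} {b : X → ℂ} (ha : Measurable a) (hb : Measurable b)
    {A C : ℝ} (hA : ∀ x, |a x| ≤ A) (hC : ∀ x, ‖b x‖ ≤ C) :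
    Differentiable ℂ fun z : ℂ => ∫ x, Complex.exp (-(Complex.I * (z * a x))) * b x ∂μ := by
  intro z₀
  have key : ∀ z ∈ Metric.ball z₀ 1, ∀ x, ‖-(Complex.I * a x) *
      (Complex.exp (-(Complex.I * (z * a x))) * b x)‖ ≤ A * (Real.exp ((‖z₀‖ + 1) * A) * C) := by
    intro z hz x
    have h0 : 0 ≤ A := (abs_nonneg _).trans (hA x)
    have h1 : ‖z‖ ≤ ‖z₀‖ + 1 := by
      have : ‖z‖ ≤ ‖z₀‖ + ‖z - z₀‖ := by simpa using norm_add_le z₀ (z - z₀)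
      have := mem_ball_iff_norm.1 hz
      linarith
    rw [norm_mul, norm_mul]
    gcongr
    · simpa using hA x
    · rw [Complex.norm_exp]
      gcongr
      refine (Complex.re_le_norm _).trans ?_
      simp only [norm_neg, norm_mul, Complex.norm_I, one_mul, Complex.norm_real, Real.norm_eq_abs]
      gcongr
      exact hA x
    · exact hC x
  have meas : ∀ z : ℂ, Measurable fun x => Complex.exp (-(Complex.I * (z * a x))) * b x := by
    intro z; fun_prop
  have hint : Integrable (fun x => Complex.exp (-(Complex.I * (z₀ * a x))) * b x) μ := by
    refine Integrable.of_bound (meas z₀).aestronglyMeasurable (Real.exp (‖z₀‖ * A) * C)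
      (Eventually.of_forall fun x => ?_)
    rw [norm_mul]
    gcongr
    · rw [Complex.norm_exp]
      gcongr
      refine (Complex.re_le_norm _).trans ?_
      simp only [norm_neg, norm_mul, Complex.norm_I, one_mul, Complex.norm_real, Real.norm_eq_abs]
      gcongr
      exact hA x
    · exact hC x
  have := hasDerivAt_integral_of_dominated_loc_of_deriv_le (μ := μ) (𝕜 := ℂ)
    (F := fun z x => Complex.exp (-(Complex.I * (z * a x))) * b x)
    (F' := fun z x => -(Complex.I * a x) * (Complex.exp (-(Complex.I * (z * a x))) * b x))
    (x₀ := z₀) (s := Metric.ball z₀ 1) (bound := fun _ => A * (Real.exp ((‖z₀‖ + 1) * A) * C))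
    (Metric.ball_mem_nhds _ one_pos) (Eventually.of_forall fun z => (meas z).aestronglyMeasurable)
    hint (by fun_prop) (Eventually.of_forall fun x z hz => key z hz x) (integrable_const _)
    (Eventually.of_forall fun x z _ => by
      have h : HasDerivAt (fun z : ℂ => -(Complex.I * (z * a x))) (-(Complex.I * (1 * a x))) z :=
        (((hasDerivAt_id z).mul_const _).const_mul _).neg
      refine (h.cexp.mul_const (b x)).congr_deriv ?_
      ring)
  exact this.2.differentiableAt

/-- A non-zero analytic function has a finite order `n` at the origin, which is incompatible with
the bound `O(x ^ (n + 1))` on the real axis. -/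
lemma eq_zero_of_isBigO_pow {f : ℂ → ℂ} (hf : Differentiable ℂ f)
    (hO : ∀ n : ℕ, (fun x : ℝ => f x) =O[𝓝 0] (fun x : ℝ => x ^ n)) (z : ℂ) : f z = 0 := by
  have ha : AnalyticOnNhd ℂ f Set.univ := hf.differentiableOn.analyticOnNhd isOpen_univ
  by_cases h : ∀ᶠ w in 𝓝 (0 : ℂ), f w = 0
  · exact congrFun (ha.eq_of_eventuallyEq (g := fun _ => 0) (fun _ _ => analyticAt_const) h) z
  · exfalso
    obtain ⟨n, g, hg, hg0, hfg⟩ :=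
      (ha 0 trivial).exists_eventuallyEq_pow_smul_nonzero_iff.2 h
    have hof : Tendsto (fun x : ℝ => (x : ℂ)) (𝓝 0) (𝓝 0) := by
      simpa using (Complex.continuous_ofReal.tendsto 0)
    have h1 : ∀ᶠ x : ℝ in 𝓝 0, f x = (x : ℂ) ^ n * g x := by
      filter_upwards [hof.eventually hfg] with x hx
      simpa using hx
    obtain ⟨C, hC⟩ := (hO (n + 1)).bound
    have h2 : ∀ᶠ x : ℝ in 𝓝[≠] 0, ‖g x‖ ≤ C * |x| := by
      filter_upwards [nhdsWithin_le_nhds h1, nhdsWithin_le_nhds hC, self_mem_nhdsWithin]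
        with x hx1 hx2 hx0
      rw [hx1, norm_mul, norm_pow, norm_pow, Complex.norm_real, Real.norm_eq_abs, pow_succ] at hx2
      have hp : 0 < |x| ^ n := pow_pos (abs_pos.2 hx0) n
      have : |x| ^ n * ‖g x‖ ≤ |x| ^ n * (C * |x|) := by linarith
      exact le_of_mul_le_mul_left this hp
    have h3 : Tendsto (fun x : ℝ => ‖g x‖) (𝓝[≠] 0) (𝓝 ‖g 0‖) :=
      (((hg.continuousAt.tendsto).comp hof).norm).mono_left nhdsWithin_le_nhds
    have h4 : Tendsto (fun x : ℝ => C * |x|) (𝓝[≠] 0) (𝓝 0) := by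
      have : Continuous fun x : ℝ => C * |x| := by fun_prop
      simpa using (this.tendsto 0).mono_left nhdsWithin_le_nhds
    have h5 := le_of_tendsto_of_tendsto h3 h4 h2
    exact hg0 (norm_le_zero_iff.1 h5)

variable [MeasurableSpace V] {B : Set V} {F : V → ℂ}

lemma HasExpType.exists_bound (h : HasExpType B F) : ∃ C, ∀ u, ‖F u‖ ≤ C := by
  obtain ⟨X, _, μ, T, b, h1, h2, h3, ⟨C, h4⟩, h5, h6⟩ := h
  refine ⟨C * μ.real Set.univ, fun u => ?_⟩
  rw [h6]
  exact norm_integral_le_of_norm_le_const (Eventually.of_forall fun x => by simpa using h4 x)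

variable [BorelSpace V]

/-- Modulation of the Fourier transform translates the carrier. -/
lemma HasExpType.wave_mul (h : HasExpType B F) (y : V) {B' : Set V}
    (hB : ∀ t ∈ B, t + y ∈ B') : HasExpType B' fun u => Rigidity.wave u y * F u := by
  obtain ⟨X, _, μ, T, b, h1, h2, h3, h4, h5, h6⟩ := h
  refine ⟨X, _, μ, fun x => T x + y, b, h1, by fun_prop, h3, h4, fun x => hB _ (h5 x), fun u => ?_⟩
  simp only [h6, wave_add_right, ← integral_const_mul]
  congr 1; ext x; ring

variable [SecondCountableTopology V]

@[fun_prop]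
lemma Measurable.wave {X : Type*} [MeasurableSpace X] {f g : X → V} (hf : Measurable f)
    (hg : Measurable g) : Measurable fun x => wave (f x) (g x) :=
  continuous_wave.measurable.comp (hf.prodMk hg)

lemma integrable_wave_mul {X : Type*} [MeasurableSpace X] {μ : Measure X} [IsFiniteMeasure μ]
    {f g : X → V} {b : X → ℂ} (hf : Measurable f) (hg : Measurable g) (hb : Measurable b) {C : ℝ}
    (hC : ∀ x, ‖b x‖ ≤ C) : Integrable (fun x => Rigidity.wave (f x) (g x) * b x) μ :=
  Integrable.of_bound (by fun_prop) C (Eventually.of_forall fun x => by simpa using hC x)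

lemma HasExpType.continuous (h : HasExpType B F) : Continuous F := by
  obtain ⟨X, _, μ, T, b, h1, h2, h3, ⟨C, h4⟩, h5, h6⟩ := h
  rw [funext h6]
  refine continuous_of_dominated (bound := fun _ => C) (fun u => by fun_prop)
    (fun u => Eventually.of_forall fun x => by simpa using h4 x) (integrable_const _)
    (Eventually.of_forall fun x => by fun_prop)

/-- Along the line through `u`, the function extends to an entire function of `z`. Vanishing to
infinite order at `z = 0` forces it to vanish at `z = 1`. This makes the repeated divisions below
terminate. -/
lemma HasExpType.eq_zero_of_isBigO (hB : Bornology.IsBounded B) (h : HasExpType B F) (u : V)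
    (hO : ∀ n : ℕ, (fun x : ℝ => F (x • u)) =O[𝓝 0] (fun x : ℝ => x ^ n)) : F u = 0 := by
  obtain ⟨X, _, μ, T, b, h1, h2, h3, ⟨C, h4⟩, h5, h6⟩ := h
  obtain ⟨A, hA⟩ := hB.exists_norm_le
  have ha : ∀ x, |(inner ℝ u (T x) : ℝ)| ≤ ‖u‖ * A := fun x =>
    (abs_real_inner_le_norm _ _).trans (by gcongr; exact hA _ (h5 x))
  have hd := differentiable_integral_exp (μ := μ) (a := fun x => inner ℝ u (T x)) (b := b)
    (by fun_prop) h3 ha h4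
  have hF : ∀ x : ℝ, F (x • u) =
      ∫ y, Complex.exp (-(Complex.I * ((x : ℂ) * (inner ℝ u (T y) : ℝ)))) * b y ∂μ := by
    intro x; rw [h6]; simp [wave, real_inner_smul_left]
  have := eq_zero_of_isBigO_pow hd (by simpa only [hF] using hO) 1
  rw [← this, h6]; simp [wave]

end ExpType

end Rigidity

namespace Rigidity

/-! ### Test functions: elementary Fourier analysis, inversion, mollifiers. -/

section Fourier

variable {d : ℕ}

lemma fourier_eq (f : E d → ℝ) (u : E d) : fourier f u = ∫ t, wave u t * (f t : ℂ) := rfl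

namespace IsCcb

variable {B : Set (E d)} {f g : E d → ℝ}

lemma mono {B' : Set (E d)} (hf : IsCcb B f) (h : B ⊆ B') : IsCcb B' f :=
  ⟨hf.1, hf.2, hf.3, hf.4.trans h⟩

lemma univ (hf : IsCcb B f) : IsCcb Set.univ f := hf.mono (Set.subset_univ _)

lemma integrable (hf : IsCcb B f) : Integrable f := by
  obtain ⟨C, hC⟩ := hf.bounded
  have h : IntegrableOn f (tsupport f) :=
    Measure.integrableOn_of_bounded hf.hasCompactSupport.measure_lt_top.ne
      hf.measurable.aestronglyMeasurable (M := C) (Eventually.of_forall fun x => hC x)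
  exact (integrableOn_iff_integrable_of_support_subset (subset_tsupport f)).1 h

lemma add (hf : IsCcb B f) (hg : IsCcb B g) : IsCcb B (f + g) := by
  obtain ⟨C, hC⟩ := hf.bounded
  obtain ⟨C', hC'⟩ := hg.bounded
  refine ⟨hf.1.add hg.1, ⟨C + C', fun x => (abs_add_le _ _).trans (add_le_add (hC x) (hC' x))⟩,
    hf.3.add hg.3, (tsupport_add f g).trans (Set.union_subset hf.4 hg.4)⟩

lemma smul (hf : IsCcb B f) (c : ℝ) : IsCcb B (c • f) := by
  obtain ⟨C, hC⟩ := hf.bounded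
  refine ⟨hf.1.const_smul c, ⟨|c| * C, fun x => ?_⟩, hf.3.smul_left (f := fun _ => c),
    (tsupport_smul_subset_right (fun _ => c) f).trans hf.4⟩
  simp only [Pi.smul_apply, smul_eq_mul, abs_mul]
  gcongr
  exact hC x

lemma sub (hf : IsCcb B f) (hg : IsCcb B g) : IsCcb B (f - g) := by
  have := hf.add (hg.smul (-1))
  rwa [neg_one_smul, ← sub_eq_add_neg] at this

lemma zero : IsCcb B (0 : E d → ℝ) :=
  ⟨measurable_const, ⟨0, by simp⟩, HasCompactSupport.zero, by simp [tsupport]⟩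

end IsCcb

lemma integrable_wave_mul_real {f : E d → ℝ} (hf : Integrable f) (u : E d) :
    Integrable fun t => wave u t * (f t : ℂ) :=
  hf.ofReal.bdd_mul (c := 1) (by fun_prop) (Eventually.of_forall fun x => by simp)

lemma fourier_add {f g : E d → ℝ} (hf : Integrable f) (hg : Integrable g) (u : E d) :
    fourier (f + g) u = fourier f u + fourier g u := by
  simp only [fourier_eq, Pi.add_apply, Complex.ofReal_add, mul_add]
  exact integral_add (integrable_wave_mul_real hf u) (integrable_wave_mul_real hg u)

lemma fourier_smul (c : ℝ) (f : E d → ℝ) (u : E d) :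
    fourier (c • f) u = c * fourier f u := by
  simp only [fourier_eq, Pi.smul_apply, smul_eq_mul, Complex.ofReal_mul, ← integral_const_mul]
  congr 1; ext t; ring

lemma fourier_sub {f g : E d → ℝ} (hf : Integrable f) (hg : Integrable g) (u : E d) :
    fourier (f - g) u = fourier f u - fourier g u := by
  simp only [fourier_eq, Pi.sub_apply, Complex.ofReal_sub, mul_sub]
  exact integral_sub (integrable_wave_mul_real hf u) (integrable_wave_mul_real hg u)

lemma fourier_neg (f : E d → ℝ) (u : E d) :
    fourier f (-u) = (starRingEnd ℂ) (fourier f u) := by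
  simp only [fourier_eq, ← integral_conj, map_mul, Complex.conj_ofReal, wave_neg_left]

lemma continuous_fourier {f : E d → ℝ} (hf : Integrable f) : Continuous (fourier f) := by
  have : fourier f = fun u => ∫ t, wave u t * (f t : ℂ) := rfl
  rw [this]
  refine continuous_of_dominated (bound := fun t => ‖f t‖)
    (fun u => (integrable_wave_mul_real hf u).aestronglyMeasurable)
    (fun u => Eventually.of_forall fun t => by simp) hf.norm
    (Eventually.of_forall fun t => by fun_prop)

lemma norm_fourier_le (f : E d → ℝ) (u : E d) : ‖fourier f u‖ ≤ ∫ t, |f t| := by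
  rw [fourier_eq]
  refine (norm_integral_le_integral_norm _).trans (le_of_eq ?_)
  simp

lemma fourier_zero (f : E d → ℝ) : fourier f 0 = ((∫ t, f t : ℝ) : ℂ) := by
  rw [fourier_eq]; simp [integral_complex_ofReal]

lemma fourier_translate (f : E d → ℝ) (y u : E d) :
    fourier (fun t => f (t - y)) u = wave u y * fourier f u := by
  simp only [fourier_eq, ← integral_const_mul]
  rw [← integral_add_right_eq_self _ y]
  congr 1; ext t
  rw [wave_add_right]; simp; ring

/-- Fourier inversion for test functions. -/
lemma fourier_inversion {g : E d → ℝ} (hg : ContDiff ℝ (⊤ : ℕ∞) g) (hc : HasCompactSupport g) :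
    Integrable (fourier g) ∧ ∀ t, ∫ u, (starRingEnd ℂ) (wave u t) * fourier g u
      = (2 * Real.pi) ^ d * (g t : ℂ) := by
  have hg' : ContDiff ℝ (⊤ : ℕ∞) fun t => (g t : ℂ) := Complex.ofRealCLM.contDiff.comp hg
  have hc' : HasCompactSupport fun t => (g t : ℂ) := hc.comp_left (g := fun x : ℝ => (x : ℂ)) rfl
  set φ := hc'.toSchwartzMap hg' with hφ
  have hφt : ∀ t, φ t = g t := fun t => rfl
  have h2 : (2 * Real.pi) ≠ 0 := by positivity
  -- Mathlib's transform has the kernel `e^{-2πi⟨v,t⟩}`; the rescaling `v = u / 2π` is the source of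
  -- the factor `(2π)^d` in the inversion.
  have key : ∀ u, fourier g u = (FourierTransform.fourier φ) ((2 * Real.pi)⁻¹ • u) := by
    intro u
    rw [SchwartzMap.fourier_coe, Real.fourier_eq', fourier_eq]
    congr 1; ext t
    rw [hφt, smul_eq_mul, wave, real_inner_smul_right, real_inner_comm]
    congr 2
    push_cast
    field_simp
  have hI : Integrable (FourierTransform.fourier φ) := (FourierTransform.fourier φ).integrable
  constructor
  · have := hI.comp_smul (R := (2 * Real.pi)⁻¹) (by positivity)
    exact this.congr (Eventually.of_forall fun u => (key u).symm)
  · intro t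
    have h1 : ∀ u, (starRingEnd ℂ) (wave u t) * fourier g u =
        (fun v => Complex.exp ((↑(2 * Real.pi * inner ℝ v t) * Complex.I)) •
          (FourierTransform.fourier φ) v) ((2 * Real.pi)⁻¹ • u) := by
      intro u
      rw [← wave_neg_right]
      simp only [key, smul_eq_mul, wave, real_inner_smul_left, inner_neg_right]
      congr 2
      push_cast
      field_simp
    have h3 := Measure.integral_comp_inv_smul_of_nonneg volume
      (fun v : E d => Complex.exp (↑(2 * Real.pi * inner ℝ v t) * Complex.I) •
        (FourierTransform.fourier φ) v) (by positivity : (0 : ℝ) ≤ 2 * Real.pi)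
    rw [integral_congr_ae (Eventually.of_forall h1), h3,
      ← Real.fourierInv_eq', ← SchwartzMap.fourierInv_coe,
      FourierTransform.fourierInv_fourier_eq, hφt]
    simp

lemma isCcb_of_continuous {g : E d → ℝ} (hg : Continuous g) (hc : HasCompactSupport g) :
    IsCcb Set.univ g := by
  obtain ⟨C, hC⟩ := hc.exists_bound_of_continuous hg
  exact ⟨hg.measurable, ⟨C, hC⟩, hc, Set.subset_univ _⟩

/-- A mollifier carried by the ball of radius `δ`. -/
lemma exists_mollifier (d : ℕ) {δ : ℝ} (hδ : 0 < δ) : ∃ χ : E d → ℝ, ContDiff ℝ (⊤ : ℕ∞) χ ∧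
    HasCompactSupport χ ∧ tsupport χ ⊆ Metric.closedBall 0 δ ∧ ∫ t, χ t = 1 ∧
    (∀ u, ‖fourier χ u‖ ≤ 1) ∧ ∀ u, ‖u‖ * δ ≤ 1 / 2 → 1 / 2 ≤ ‖fourier χ u‖ := by
  let φ : ContDiffBump (0 : E d) := ⟨δ / 2, δ, by positivity, by linarith⟩
  have hc : HasCompactSupport (φ.normed volume) := φ.hasCompactSupport_normed
  have hs : tsupport (φ.normed volume) = Metric.closedBall 0 δ := φ.tsupport_normed_eq
  have hi : Integrable (φ.normed volume) := φ.integrable_normed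
  have hint : ∫ t, φ.normed volume t = 1 := φ.integral_normed
  refine ⟨φ.normed volume, φ.contDiff_normed, hc, hs.le, hint, fun u => ?_, fun u hu => ?_⟩
  · refine (norm_fourier_le _ u).trans (le_of_eq ?_)
    rw [← hint]; congr 1; ext t; exact abs_of_nonneg (φ.nonneg_normed t)
  -- The mollifier is a probability density, and on its support `|e^{-i⟨u,t⟩} - 1| ≤ ‖u‖ δ ≤ 1/2`.
  · have h1 : ‖fourier (φ.normed volume) u - 1‖ ≤ 1 / 2 := by
      have : (1 : ℂ) = ∫ t, ((φ.normed volume t : ℝ) : ℂ) := by rw [integral_complex_ofReal, hint]; simp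
      have hic : Integrable fun t => ((φ.normed volume t : ℝ) : ℂ) := hi.ofReal
      rw [fourier_eq, this, ← integral_sub (integrable_wave_mul_real hi u) hic]
      refine (norm_integral_le_of_norm_le (hi.const_mul (1 / 2)) (Eventually.of_forall fun t => ?_)).trans
        (by rw [integral_const_mul, hint, mul_one])
      rw [← sub_one_mul, norm_mul, Complex.norm_real, Real.norm_eq_abs,
        abs_of_nonneg (φ.nonneg_normed t)]
      by_cases ht : t ∈ Metric.closedBall (0 : E d) δ
      · gcongr
        · exact φ.nonneg_normed t
        · refine (norm_wave_sub_one_le u t).trans ?_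
          refine (norm_inner_le_norm u t).trans (le_trans ?_ hu)
          gcongr
          simpa using ht
      · have : φ.normed volume t = 0 := image_eq_zero_of_notMem_tsupport (by rwa [hs])
        simp [this]
    have h2 := norm_sub_norm_le (1 : ℂ) (1 - fourier (φ.normed volume) u)
    rw [norm_sub_rev] at h1
    simp only [sub_sub_cancel, norm_one] at h2
    linarith

end Fourier

end Rigidity

namespace Rigidity

/-! ### Reduction to `L²(N)` and annihilators of the statistics off `A`. -/

namespace RandomMeasure

variable {d : ℕ} {Ω : Type*} [MeasurableSpace Ω] {P : Measure Ω} {M : RandomMeasure d P}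

lemma I_sub (M : RandomMeasure d P) {f g : E d → ℝ} (hf : IsCcb Set.univ f)
    (hg : IsCcb Set.univ g) : M.I (f - g) =ᵐ[P] M.I f - M.I g := by
  have h1 := M.add f ((-1 : ℝ) • g) hf (hg.smul _)
  have h2 := M.smul (-1) g hg
  filter_upwards [h1, h2] with ω h1 h2
  rw [sub_eq_add_neg, ← neg_one_smul ℝ g, h1, h2]
  simp; ring

/-- `N` is the even measure which represents the second moments of the linear statistics. -/
structure IsMomentMeasure (M : RandomMeasure d P) (N : Measure (E d)) : Prop where
  even : N.map (fun u => -u) = N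
  lintegral_eq : ∀ f, IsCcb Set.univ f →
    ∫⁻ ω, ‖M.I f ω‖ₑ ^ 2 ∂P = ∫⁻ u, ‖fourier f u‖ₑ ^ 2 ∂N

/-- The second moment is the variance plus the squared mean, and the mean is `c ∫ f = c f̂(0)`;
hence the extra atom of mass `c²` at the origin. -/
lemma IsSpectralMeasure.isMomentMeasure [IsProbabilityMeasure P] {S : Measure (E d)}
    (hS : M.IsSpectralMeasure S) {c : ℝ}
    (hc : ∀ f, IsCcb Set.univ f → ∫ ω, M.I f ω ∂P = c * ∫ t, f t) :
    M.IsMomentMeasure (S + ENNReal.ofReal (c ^ 2) • Measure.dirac 0) := by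
  constructor
  · rw [Measure.map_add _ _ measurable_neg, hS.even, Measure.map_smul,
      Measure.map_dirac' measurable_neg, neg_zero]
  · intro f hf
    have hm := M.memLp f hf
    have hv := variance_eq_sub hm
    have h1 : ∫⁻ ω, ‖M.I f ω‖ₑ ^ 2 ∂P = ENNReal.ofReal (∫ ω, (M.I f ω) ^ 2 ∂P) := by
      rw [ofReal_integral_eq_lintegral_ofReal hm.integrable_sq
        (Eventually.of_forall fun ω => sq_nonneg _)]
      congr 1; ext ω
      rw [← ofReal_norm, ← ENNReal.ofReal_pow (norm_nonneg _), Real.norm_eq_abs, sq_abs]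
    have h2 : ∫ ω, (M.I f ω) ^ 2 ∂P = variance (M.I f) P + (c * ∫ t, f t) ^ 2 := by
      rw [hv, hc f hf]; simp
    rw [h1, h2, ENNReal.ofReal_add (variance_nonneg _ _) (sq_nonneg _), hS.variance_eq f hf,
      lintegral_add_measure, lintegral_smul_measure, lintegral_dirac, fourier_zero, mul_pow,
      ENNReal.ofReal_mul (sq_nonneg _)]
    congr 2
    rw [← ofReal_norm, Complex.norm_real, ← ENNReal.ofReal_pow (norm_nonneg _),
      Real.norm_eq_abs, sq_abs]

variable {N : Measure (E d)} (hN : M.IsMomentMeasure N)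

include hN

lemma IsMomentMeasure.eLpNorm_eq {f : E d → ℝ} (hf : IsCcb Set.univ f) :
    eLpNorm (M.I f) 2 P = eLpNorm (fourier f) 2 N := by
  have := hN.lintegral_eq f hf
  simp only [eLpNorm_eq_lintegral_rpow_enorm_toReal (p := 2) (by norm_num) (by norm_num)]
  simpa using congrArg (fun x => x ^ (1 / 2 : ℝ)) this

lemma IsMomentMeasure.memLp {f : E d → ℝ} (hf : IsCcb Set.univ f) : MemLp (fourier f) 2 N :=
  ⟨(continuous_fourier hf.integrable).aestronglyMeasurable,
    by rw [← hN.eLpNorm_eq hf]; exact (M.memLp f hf).2⟩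

lemma IsMomentMeasure.eLpNorm_sub_eq {f g : E d → ℝ} (hf : IsCcb Set.univ f)
    (hg : IsCcb Set.univ g) :
    eLpNorm (M.I f - M.I g) 2 P = eLpNorm (fourier f - fourier g) 2 N := by
  rw [← eLpNorm_congr_ae (M.I_sub hf hg), hN.eLpNorm_eq (hf.sub hg)]
  congr 1; ext u; exact fourier_sub hf.integrable hg.integrable u

/-- Convergence in `L²` suffices for rigidity, since a subsequence also converges almost surely. -/
lemma IsMomentMeasure.linearlyRigid_of_tendsto {A : Set (E d)} {γ : E d → ℝ}
    (hγ : IsCcb Set.univ γ) {h : ℕ → E d → ℝ} (hh : ∀ n, IsCcb Aᶜ (h n))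
    (hlim : Tendsto (fun n => eLpNorm (fourier (h n) - fourier γ) 2 N) atTop (𝓝 0)) :
    M.LinearlyRigid γ A := by
  have hlim' : Tendsto (fun n => eLpNorm (M.I (h n) - M.I γ) 2 P) atTop (𝓝 0) := by
    refine hlim.congr fun n => ?_
    rw [hN.eLpNorm_sub_eq (hh n).univ hγ]
  have := tendstoInMeasure_of_tendsto_eLpNorm (by norm_num)
    (fun n => (M.memLp _ (hh n).univ).1) (M.memLp _ hγ).1 hlim'
  obtain ⟨ns, hns, hae⟩ := this.exists_seq_tendsto_ae
  exact ⟨fun n => h (ns n), fun n => hh _, hae, hlim'.comp hns.tendsto_atTop⟩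

/-- Test functions are real, so their transforms form only a real subspace of `L²(N)`. The
orthogonality is therefore taken for the real inner product and concerns only the real part. -/
lemma IsMomentMeasure.exists_orthogonal {A : Set (E d)}
    (hmax : ¬ M.LinearlyMaximallyRigid A) : ∃ φ : Lp ℂ 2 N,
      (∀ h, IsCcb Aᶜ h → (∫ u, fourier h u * (starRingEnd ℂ) (φ u) ∂N).re = 0) ∧
      ∃ γ, IsCcb Set.univ γ ∧ (∫ u, fourier γ u * (starRingEnd ℂ) (φ u) ∂N).re ≠ 0 := by
  unfold LinearlyMaximallyRigid at hmax
  push Not at hmax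
  obtain ⟨γ, hγ, hrig⟩ := hmax
  let V : Submodule ℝ (Lp ℂ 2 N) :=
    { carrier := {x | ∃ h, IsCcb Aᶜ h ∧ x =ᵐ[N] fourier h}
      add_mem' := by
        rintro x y ⟨f, hf, hx⟩ ⟨g, hg, hy⟩
        refine ⟨f + g, hf.add hg, ?_⟩
        filter_upwards [hx, hy, Lp.coeFn_add x y] with u h1 h2 h3
        rw [h3, Pi.add_apply, h1, h2, fourier_add hf.integrable hg.integrable]
      zero_mem' := by
        refine ⟨0, IsCcb.zero, ?_⟩
        filter_upwards [Lp.coeFn_zero ℂ 2 N] with u h1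
        rw [h1]; simp [fourier_eq]
      smul_mem' := by
        rintro c x ⟨f, hf, hx⟩
        refine ⟨c • f, hf.smul c, ?_⟩
        filter_upwards [hx, Lp.coeFn_smul c x] with u h1 h2
        rw [h2, Pi.smul_apply, h1, fourier_smul]; simp }
  have hre : ∀ (x φ : Lp ℂ 2 N) (f : E d → ℝ), x =ᵐ[N] fourier f →
      inner ℝ φ x = (∫ u, fourier f u * (starRingEnd ℂ) (φ u) ∂N).re := by
    intro x φ f hx
    have hi : Integrable (fun u => fourier f u * (starRingEnd ℂ) (φ u)) N :=
      ((memLp_congr_ae hx).1 (Lp.memLp x)).integrable_mul (Lp.memLp φ).star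
    have hre := integral_re hi
    simp only [RCLike.re_eq_complex_re] at hre
    rw [L2.inner_def, ← hre]
    refine integral_congr_ae ?_
    filter_upwards [hx] with u hu
    rw [Complex.inner, hu, mul_comm]
  set x := (hN.memLp hγ).toLp with hx
  have hxγ : x =ᵐ[N] fourier γ := (hN.memLp hγ).coeFn_toLp
  have hnot : x ∉ V.topologicalClosure := by
    intro hmem
    apply hrig
    rw [← SetLike.mem_coe, Submodule.topologicalClosure_coe, mem_closure_iff_seq_limit] at hmem
    obtain ⟨y, hy, hlim⟩ := hmem
    choose h hh hyh using hy
    refine hN.linearlyRigid_of_tendsto hγ hh ?_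
    have := (Lp.tendsto_Lp_iff_tendsto_eLpNorm' y x).1 hlim
    refine this.congr fun n => eLpNorm_congr_ae ?_
    filter_upwards [hxγ, hyh n] with u h1 h2
    simp [h1, h2]
  rw [← Submodule.orthogonal_orthogonal_eq_closure, Submodule.mem_orthogonal] at hnot
  push Not at hnot
  obtain ⟨φ, hφ, hne⟩ := hnot
  refine ⟨φ, fun h hh => ?_, γ, hγ, ?_⟩
  · have hh' := (hN.memLp hh.univ).coeFn_toLp
    rw [← hre _ φ h hh', real_inner_comm]
    exact (Submodule.mem_orthogonal _ _).1 hφ _ ⟨h, hh, hh'⟩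
  · rwa [← hre x φ γ hxγ]

/-- Since `f̂(-u)` is the conjugate of `f̂(u)` and `N` is even, pairing `f̂` with `conj φ(u) +
φ(-u)` gives twice the real part of its pairing with `conj φ`. The symmetrised function thus turns
vanishing real parts into vanishing integrals. -/
lemma IsMomentMeasure.exists_annihilator {A : Set (E d)}
    (hmax : ¬ M.LinearlyMaximallyRigid A) : ∃ p : E d → ℂ, Measurable p ∧ MemLp p 2 N ∧
      (∀ h, IsCcb Aᶜ h → ∫ u, fourier h u * p u ∂N = 0) ∧
      ∃ γ, IsCcb Set.univ γ ∧ ∫ u, fourier γ u * p u ∂N ≠ 0 := by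
  obtain ⟨φ, h0, γ, hγ, hne⟩ := hN.exists_orthogonal hmax
  have hmp : MeasurePreserving (fun u : E d => -u) N N := ⟨measurable_neg, hN.even⟩
  have hφm : Measurable φ := (Lp.stronglyMeasurable φ).measurable
  have hφ : MemLp φ 2 N := Lp.memLp φ
  have hφc : MemLp (fun u => (starRingEnd ℂ) (φ u)) 2 N := hφ.star
  have hφn : MemLp (fun u => φ (-u)) 2 N := hφ.comp_measurePreserving hmp
  have key : ∀ f, IsCcb Set.univ f → ∫ u, fourier f u * ((starRingEnd ℂ) (φ u) + φ (-u)) ∂N =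
      ((2 * (∫ u, fourier f u * (starRingEnd ℂ) (φ u) ∂N).re : ℝ) : ℂ) := by
    intro f hf
    have hF := hN.memLp hf
    have i1 : Integrable (fun u => fourier f u * (starRingEnd ℂ) (φ u)) N := hF.integrable_mul hφc
    have i2 : Integrable (fun u => fourier f u * φ (-u)) N := hF.integrable_mul hφn
    have e2 : ∫ u, fourier f u * φ (-u) ∂N =
        (starRingEnd ℂ) (∫ u, fourier f u * (starRingEnd ℂ) (φ u) ∂N) := by
      rw [← integral_conj, ← hmp.integral_comp (MeasurableEquiv.neg (E d)).measurableEmbedding]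
      congr 1; ext u
      simp [fourier_neg]
    simp only [mul_add]
    rw [integral_add i1 i2, e2, Complex.add_conj]
  refine ⟨fun u => (starRingEnd ℂ) (φ u) + φ (-u), ?_, hφc.add hφn, fun h hh => ?_, γ, hγ, ?_⟩
  · exact (Complex.continuous_conj.measurable.comp hφm).add (hφm.comp measurable_neg)
  · rw [key h hh.univ, h0 h hh]; simp
  · rw [key γ hγ]
    simpa using hne

end RandomMeasure

end Rigidity

namespace Rigidity

/-! ### From an annihilator to a density of exponential type. -/

variable {d : ℕ}

/-- If `w • N` and `F • volume` agree on test functions, then `w • N` has no singular part and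
`F` is its density. -/
lemma density_eq_of_integral_contDiff_eq {N ν : Measure (E d)} {s : E d → ℝ≥0}
    [IsLocallyFiniteMeasure ν]
    (hs : Measurable s) (hν : Measure.MutuallySingular ν volume)
    (hN : N = volume.withDensity (fun u => (s u : ℝ≥0∞)) + ν) {w F : E d → ℂ}
    (hwN : Integrable w N) (hF : Continuous F)
    (h : ∀ g : E d → ℝ, ContDiff ℝ (⊤ : ℕ∞) g → HasCompactSupport g →
      ∫ u, g u • w u ∂N = ∫ u, g u • F u) :
    (∀ᵐ u, F u = s u • w u) ∧ ∀ᵐ u ∂ν, w u = 0 := by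
  obtain ⟨Z, hZ, hνZ, hvZ⟩ := hν
  rw [hN] at hwN
  obtain ⟨hw1, hw2⟩ := integrable_add_measure.1 hwN
  have hsw : Integrable (fun u => s u • w u) :=
    (integrable_withDensity_iff_integrable_smul hs).1 hw1
  classical
  set W : E d → ℂ := Z.piecewise (fun u => s u • w u - F u) w with hW
  have hWv : W =ᵐ[volume] fun u => s u • w u - F u := by
    have : ∀ᵐ u, u ∈ Z := hvZ
    filter_upwards [this] with u hu
    simp [hW, hu]
  have hWν : W =ᵐ[ν] w := by
    have : ∀ᵐ u ∂ν, u ∉ Z := by rw [ae_iff]; simpa using hνZ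
    filter_upwards [this] with u hu
    simp [hW, hu]
  have hvW : LocallyIntegrable W volume :=
    (hsw.locallyIntegrable.sub hF.locallyIntegrable).congr hWv.symm
  have hνW : LocallyIntegrable W ν := (hw2.congr hWν.symm).locallyIntegrable
  have hloc : LocallyIntegrable W (volume + ν) := by
    intro x
    obtain ⟨U, hU, hUi⟩ := hvW x
    obtain ⟨U', hU', hUi'⟩ := hνW x
    refine ⟨U ∩ U', inter_mem hU hU', ?_⟩
    exact (hUi.mono_set Set.inter_subset_left).add_measure (hUi'.mono_set Set.inter_subset_right)
  have h0 := ae_eq_zero_of_integral_contDiff_smul_eq_zero hloc (fun g hg hgc => ?_)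
  · rw [ae_add_measure_iff] at h0
    refine ⟨?_, ?_⟩
    · filter_upwards [h0.1, hWv] with u h1 h2
      exact (sub_eq_zero.1 (h2.symm.trans h1)).symm
    · filter_upwards [h0.2, hWν] with u h1 h2
      exact h2.symm.trans h1
  · obtain ⟨C, hC⟩ := hgc.exists_bound_of_continuous hg.continuous
    have bdd : ∀ (μ : Measure (E d)) (f : E d → ℂ), Integrable f μ →
        Integrable (fun u => g u • f u) μ := fun μ f hf =>
      hf.bdd_smul C hg.continuous.aestronglyMeasurable (Eventually.of_forall hC)
    have i1 := bdd _ _ hsw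
    have i2 : Integrable fun u => g u • F u :=
      (hg.continuous.smul hF).integrable_of_hasCompactSupport hgc.smul_right
    have i3 := bdd _ _ hw2
    have e1 : ∫ u, g u • W u = (∫ u, g u • (s u • w u)) - ∫ u, g u • F u := by
      rw [← integral_sub i1 i2]
      refine integral_congr_ae ?_
      filter_upwards [hWv] with u hu
      rw [hu, smul_sub]
    have e2 : ∫ u, g u • W u ∂ν = ∫ u, g u • w u ∂ν := by
      refine integral_congr_ae ?_
      filter_upwards [hWν] with u hu
      rw [hu]
    have i1' : Integrable (fun u => g u • W u) := (i1.sub i2).congr (by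
      filter_upwards [hWv] with u hu
      simp [hu, smul_sub])
    have i3' : Integrable (fun u => g u • W u) ν := i3.congr (by
      filter_upwards [hWν] with u hu
      rw [hu])
    rw [integral_add_measure i1' i3', e1, e2, ← h g hg hgc, hN,
      integral_add_measure (bdd _ _ hw1) i3, integral_withDensity_eq_integral_smul hs]
    have : ∀ u, s u • (g u • w u) = g u • (s u • w u) := fun u => smul_comm _ _ _
    simp only [this]
    ring

namespace RandomMeasure

variable {Ω : Type*} [MeasurableSpace Ω] {P : Measure Ω} {M : RandomMeasure d P}

/-- A sufficiently concentrated mollifier has `|χ̂| ≥ 1/2` on a given ball, while `∫ |χ̂|² dN` is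
the finite second moment of a linear statistic. -/
lemma IsMomentMeasure.isLocallyFiniteMeasure {N : Measure (E d)} (hN : M.IsMomentMeasure N) :
    IsLocallyFiniteMeasure N := by
  refine ⟨fun x => ⟨Metric.ball 0 (‖x‖ + 1), Metric.isOpen_ball.mem_nhds (by simp), ?_⟩⟩
  obtain ⟨χ, hχ, hχc, -, -, -, hlow⟩ :=
    exists_mollifier d (δ := (2 * (‖x‖ + 1))⁻¹) (by positivity)
  have hf := isCcb_of_continuous hχ.continuous hχc
  have hfin : ∫⁻ u, ‖fourier χ u‖ₑ ^ 2 ∂N < ∞ := by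
    rw [← hN.lintegral_eq χ hf]
    have := (lintegral_rpow_enorm_lt_top_of_eLpNorm_lt_top (by norm_num) (by norm_num)
      (M.memLp χ hf).2)
    simpa using this
  have h1 : ∫⁻ u in Metric.ball 0 (‖x‖ + 1), ENNReal.ofReal (1 / 4) ∂N ≤
      ∫⁻ u, ‖fourier χ u‖ₑ ^ 2 ∂N := by
    refine (setLIntegral_mono' measurableSet_ball fun u hu => ?_).trans (setLIntegral_le_lintegral _ _)
    have h2 : 1 / 2 ≤ ‖fourier χ u‖ := by
      apply hlow
      have : ‖u‖ < ‖x‖ + 1 := by simpa using hu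
      rw [mul_inv, ← mul_assoc, mul_comm, ← mul_assoc, inv_mul_eq_div, div_mul_eq_mul_div,
        div_le_div_iff₀ (by positivity) (by norm_num)]
      nlinarith
    rw [← ofReal_norm, ← ENNReal.ofReal_pow (norm_nonneg _)]
    apply ENNReal.ofReal_le_ofReal
    nlinarith
  rw [lintegral_const, Measure.restrict_apply_univ] at h1
  by_contra hcon
  rw [not_lt, top_le_iff] at hcon
  rw [hcon, ENNReal.mul_top (by simp)] at h1
  exact absurd (h1.trans_lt hfin) (lt_irrefl _)

/-- The Fourier transform of a mollified annihilator of the linear statistics outside of `A` is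
the density of an absolutely continuous measure. -/
lemma IsMomentMeasure.exists_expType_of_mollifier {N ν : Measure (E d)} {s : E d → ℝ≥0}
    (hM : M.IsMomentMeasure N) (hs : Measurable s) (hν : Measure.MutuallySingular ν volume)
    (hN : N = volume.withDensity (fun u => (s u : ℝ≥0∞)) + ν) {A B : Set (E d)} {p : E d → ℂ}
    (hpm : Measurable p) (hp : MemLp p 2 N)
    (hpA : ∀ h, IsCcb Aᶜ h → ∫ u, fourier h u * p u ∂N = 0) {δ : ℝ}
    (hBm : MeasurableSet B) (hBb : Bornology.IsBounded B) (hB0 : (0 : E d) ∈ B)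
    (hAB : ∀ a ∈ A, ∀ t, ‖t + a‖ ≤ δ → t ∈ B) {χ : E d → ℝ} (hχ : ContDiff ℝ (⊤ : ℕ∞) χ)
    (hχc : HasCompactSupport χ) (hχs : tsupport χ ⊆ Metric.closedBall 0 δ) :
    ∃ F : E d → ℂ, HasExpType B F ∧ (∀ᵐ u, F u = s u • (fourier χ u * p u)) ∧
      ∀ᵐ u ∂ν, fourier χ u * p u = 0 := by
  have : IsLocallyFiniteMeasure N := hM.isLocallyFiniteMeasure
  have hνN : ν ≤ N := by rw [hN]; exact Measure.le_add_left le_rfl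
  have : IsLocallyFiniteMeasure ν := Measure.isLocallyFiniteMeasure_of_le hνN
  have hχ1 := isCcb_of_continuous hχ.continuous hχc
  set w : E d → ℂ := fun u => fourier χ u * p u with hw
  have hwi : Integrable w N := (hM.memLp hχ1).integrable_mul hp
  have hwm : Measurable w := (continuous_fourier hχ1.integrable).measurable.mul hpm
  -- Up to normalisation, `q` is the inverse Fourier transform of the finite complex measure `w N`.
  set q : E d → ℂ := fun t => ∫ u, (starRingEnd ℂ) (wave u t) * w u ∂N with hq
  have hwt : ∀ t, Integrable (fun u => (starRingEnd ℂ) (wave u t) * w u) N := fun t =>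
    hwi.bdd_mul (c := 1) (by
      have : Measurable fun u => (starRingEnd ℂ) (wave u t) :=
        Complex.continuous_conj.measurable.comp (by fun_prop)
      exact this.aestronglyMeasurable) (Eventually.of_forall fun x => by simp)
  have hqc : Continuous q := by
    refine continuous_of_dominated (bound := fun u => ‖w u‖)
      (fun t => (hwt t).aestronglyMeasurable)
      (fun t => Eventually.of_forall fun u => by simp) hwi.norm
      (Eventually.of_forall fun u => ?_)
    have : Continuous fun t => (starRingEnd ℂ) (wave u t) :=
      Complex.continuous_conj.comp (by fun_prop)
    fun_prop
  have hqb : ∀ t, ‖q t‖ ≤ ∫ u, ‖w u‖ ∂N := fun t => by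
    refine (norm_integral_le_integral_norm _).trans (le_of_eq ?_)
    simp
  -- `q t` is the pairing of `p` with the transform of `χ` translated by `-t`. For `t ∉ B` that
  -- translate is supported off `A`, so `p` annihilates it.
  have hq0 : ∀ t, t ∉ B → q t = 0 := by
    intro t ht
    have hh : IsCcb Aᶜ fun x => χ (x - -t) := by
      refine ⟨?_, ?_, ?_, ?_⟩
      · exact hχ1.measurable.comp (measurable_id.sub_const _)
      · obtain ⟨C, hC⟩ := hχ1.bounded
        exact ⟨C, fun x => hC _⟩
      · exact hχc.comp_homeomorph (Homeomorph.subRight (-t))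
      · intro x hx hxA
        apply ht
        refine hAB x hxA t ?_
        have h1 := tsupport_comp_subset_preimage χ (f := fun x => x - -t) (by fun_prop) hx
        have := hχs h1
        simpa [add_comm] using this
    have := hpA _ hh
    rw [← this]
    refine integral_congr_ae (Eventually.of_forall fun u => ?_)
    dsimp only
    rw [fourier_translate, wave_neg_right]
    simp only [hw]; ring
  set c : ℂ := ((2 * Real.pi : ℂ) ^ d)⁻¹ with hc
  have hcne : (2 * Real.pi : ℂ) ^ d ≠ 0 := by
    have : (Real.pi : ℂ) ≠ 0 := by exact_mod_cast Real.pi_ne_zero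
    exact pow_ne_zero _ (mul_ne_zero two_ne_zero this)
  set b : E d → ℂ := fun t => c * q t with hb
  have hbm : Measurable b := by fun_prop
  set F : E d → ℂ := fun u => ∫ t in B, wave u t * b t with hF
  have hBfin : IsFiniteMeasure (volume.restrict B) :=
    ⟨by simpa using hBb.measure_lt_top⟩
  have hFB : HasExpType B F := by
    classical
    -- The carrier condition is required at every point; the value `0 ∈ B` is only a default on a
    -- null set of the restricted measure.
    refine ⟨E d, inferInstance, volume.restrict B, fun t => if t ∈ B then t else 0, b, hBfin,
      Measurable.ite hBm measurable_id measurable_const, hbm,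
      ⟨‖c‖ * ∫ u, ‖w u‖ ∂N, fun t => ?_⟩, fun t => ?_, fun u => ?_⟩
    · rw [hb, norm_mul]; gcongr; exact hqb t
    · dsimp only
      split_ifs with h <;> assumption
    · refine setIntegral_congr_fun hBm fun t ht => ?_
      simp [ht]
  refine ⟨F, hFB, density_eq_of_integral_contDiff_eq hs hν hN hwi hFB.continuous
    fun g hg hgc => ?_⟩
  obtain ⟨hgi, hginv⟩ := fourier_inversion hg hgc
  have hg1 := (isCcb_of_continuous hg.continuous hgc).integrable
  have hgm := hg.continuous.measurable
  have hgfm := (continuous_fourier hg1).measurable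
  have hbi : Integrable b (volume.restrict B) :=
    Integrable.of_bound hbm.aestronglyMeasurable (‖c‖ * ∫ u, ‖w u‖ ∂N)
      (Eventually.of_forall fun t => by rw [hb, norm_mul]; gcongr; exact hqb t)
  have fub1 : ∫ u, g u • F u = ∫ t in B, fourier g t * b t := by
    have hint : Integrable (Function.uncurry fun u t => (g u : ℂ) * (wave u t * b t))
        (volume.prod (volume.restrict B)) := by
      refine (hg1.ofReal (𝕜 := ℂ).mul_prod hbi).mono ?_ (Eventually.of_forall fun z => ?_)
      · have : Measurable (Function.uncurry fun u t => (g u : ℂ) * (wave u t * b t)) := by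
          unfold Function.uncurry; fun_prop
        exact this.aestronglyMeasurable
      · simp [Function.uncurry]
    have e1 : ∀ u, g u • F u = ∫ t in B, (g u : ℂ) * (wave u t * b t) := by
      intro u
      rw [integral_const_mul, Complex.real_smul]
    simp only [e1]
    rw [integral_integral_swap hint]
    congr 1; ext t
    rw [fourier_eq, ← integral_mul_const]
    congr 1; ext u
    rw [wave_comm]; ring
  have e2 : ∫ t in B, fourier g t * b t = ∫ t, fourier g t * b t :=
    setIntegral_eq_integral_of_forall_compl_eq_zero fun t ht => by simp [hb, hq0 t ht]
  -- After the interchange, inversion for `g` produces `(2π)^d g`, and the constant `c` cancels the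
  -- factor.
  have fub2 : ∫ t, fourier g t * b t = ∫ u, g u • w u ∂N := by
    have hint : Integrable (Function.uncurry fun t u =>
        fourier g t * (c * ((starRingEnd ℂ) (wave u t) * w u))) (volume.prod N) := by
      refine ((hgi.const_mul c).mul_prod hwi).mono ?_ (Eventually.of_forall fun z => ?_)
      · have h1 : Measurable fun z : E d × E d => (starRingEnd ℂ) (wave z.2 z.1) :=
          Complex.continuous_conj.measurable.comp (by fun_prop)
        have : Measurable (Function.uncurry fun t u =>
            fourier g t * (c * ((starRingEnd ℂ) (wave u t) * w u))) := by
          unfold Function.uncurry; fun_prop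
        exact this.aestronglyMeasurable
      · simp only [Function.uncurry, norm_mul, RCLike.norm_conj, norm_wave]
        apply le_of_eq; ring
    have e1 : ∀ t, fourier g t * b t =
        ∫ u, fourier g t * (c * ((starRingEnd ℂ) (wave u t) * w u)) ∂N := by
      intro t
      rw [integral_const_mul, integral_const_mul]
    simp only [e1]
    rw [integral_integral_swap hint]
    congr 1; ext u
    have : ∀ t, fourier g t * (c * ((starRingEnd ℂ) (wave u t) * w u)) =
        (starRingEnd ℂ) (wave t u) * fourier g t * (c * w u) := by
      intro t; rw [wave_comm]; ring
    simp only [this]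
    rw [integral_mul_const, hginv, Complex.real_smul, hc]
    field_simp
  rw [fub1, e2, fub2]

end RandomMeasure

end Rigidity

namespace Rigidity

variable {d : ℕ}

/-! ### Failure of maximal rigidity produces a function of exponential type. -/

namespace RandomMeasure

variable {Ω : Type*} [MeasurableSpace Ω] {P : Measure Ω} {M : RandomMeasure d P}

/-- The atom at the origin joins the singular part. This needs `d ≠ 0`: in dimension zero a point
mass is not singular to Lebesgue measure. -/
lemma exists_isMomentMeasure [IsProbabilityMeasure P] [NeZero d]
    (hM : M.IsWideSenseStationary) {s : E d → ℝ≥0} (hs : M.IsSpectralDensity s) :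
    ∃ N ν : Measure (E d), M.IsMomentMeasure N ∧ Measure.MutuallySingular ν volume ∧
      N = volume.withDensity (fun u => (s u : ℝ≥0∞)) + ν := by
  obtain ⟨c, hc⟩ := hM.exists_intensity
  obtain ⟨-, S, ν, hS, hν, hSeq⟩ := hs
  refine ⟨_, ν + ENNReal.ofReal (c ^ 2) • Measure.dirac 0, hS.isMomentMeasure hc,
    hν.add_left ?_, ?_⟩
  · exact (mutuallySingular_dirac 0 (volume : Measure (E d))).smul _
  · rw [hSeq, add_assoc]

/-- If `M` is not maximally rigid on `A`, then there is a non-zero function of exponential type,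
carried by a neighbourhood of `-A`, which is square integrable for the weight `1 / s`. -/
lemma exists_expType_of_not_linearlyMaximallyRigid [IsProbabilityMeasure P] [NeZero d]
    (hM : M.IsWideSenseStationary) {s : E d → ℝ≥0} (hs : M.IsSpectralDensity s)
    {A B : Set (E d)} (hmax : ¬ M.LinearlyMaximallyRigid A)
    (hBm : MeasurableSet B) (hBb : Bornology.IsBounded B) (hB0 : (0 : E d) ∈ B) {δ : ℝ} (hδ : 0 < δ)
    (hAB : ∀ a ∈ A, ∀ t, ‖t + a‖ ≤ δ → t ∈ B) :
    ∃ F : E d → ℂ, HasExpType B F ∧ (∃ u, F u ≠ 0) ∧ ∫⁻ u, ‖F u‖ₑ ^ 2 / (s u : ℝ≥0∞) < ∞ := by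
  obtain ⟨N, ν, hMN, hν, hN⟩ := exists_isMomentMeasure hM hs
  obtain ⟨p, hpm, hp, hpA, γ, hγ, hγp⟩ := hMN.exists_annihilator hmax
  -- The radii shrink to `0` so that each `u` has some `χ n` with `χ̂ₙ(u) ≠ 0`. If every `F n`
  -- vanished, then `p = 0` almost everywhere for `N`, contradicting its non-zero pairing with `γ̂`.
  have hδn : ∀ n : ℕ, 0 < δ / (n + 1) := fun n => by positivity
  choose χ h1 h2 h3 h4 h5 h6 using fun n => exists_mollifier d (hδn n)
  choose F hF1 hF2 hF3 using fun n => hMN.exists_expType_of_mollifier hs.1 hν hN hpm hp hpA hBm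
    hBb hB0 hAB (h1 n) (h2 n) ((h3 n).trans (Metric.closedBall_subset_closedBall
      (div_le_self hδ.le (by simp))))
  have hne : ∃ n, ∃ u, F n u ≠ 0 := by
    by_contra hcon
    push Not at hcon
    have hae : ∀ᵐ u ∂N, ∀ n, fourier (χ n) u * p u = 0 := by
      rw [ae_all_iff]
      intro n
      rw [hN, ae_add_measure_iff]
      refine ⟨?_, hF3 n⟩
      rw [ae_withDensity_iff hs.1.coe_nnreal_ennreal]
      filter_upwards [hF2 n] with u hu hsu
      rw [hcon n u] at hu
      exact (smul_eq_zero.1 hu.symm).resolve_left (by simpa using hsu)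
    apply hγp
    refine integral_eq_zero_of_ae ?_
    filter_upwards [hae] with u hu
    obtain ⟨n, hn⟩ := exists_nat_ge (2 * (‖u‖ * δ))
    have hlow := h6 n u (by
      rw [← mul_div_assoc, div_le_div_iff₀ (by positivity) (by norm_num)]; linarith)
    have : p u = 0 := (mul_eq_zero.1 (hu n)).resolve_left (by
      intro h0; rw [h0, norm_zero] at hlow; linarith)
    simp [this]
  obtain ⟨n, hn⟩ := hne
  refine ⟨F n, hF1 n, hn, ?_⟩
  have hpfin : ∫⁻ u, ‖p u‖ₑ ^ 2 ∂N < ∞ := by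
    have := lintegral_rpow_enorm_lt_top_of_eLpNorm_lt_top (by norm_num) (by norm_num) hp.2
    simpa using this
  refine lt_of_le_of_lt ?_ hpfin
  -- From `F = s χ̂ p` and `|χ̂| ≤ 1`. Zeros of `s` are harmless: there `F = 0` almost everywhere,
  -- and `0 / 0 = 0` in `ℝ≥0∞`.
  calc ∫⁻ u, ‖F n u‖ₑ ^ 2 / (s u : ℝ≥0∞) ≤ ∫⁻ u, (s u : ℝ≥0∞) * ‖p u‖ₑ ^ 2 := by
        refine lintegral_mono_ae ?_
        filter_upwards [hF2 n] with u hu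
        have hle : ‖F n u‖ₑ ≤ s u * ‖p u‖ₑ := by
          have hχ : ‖fourier (χ n) u‖ₑ ≤ 1 := by
            rw [← ofReal_norm, ENNReal.ofReal_le_one]; exact h5 n u
          rw [hu, NNReal.smul_def, enorm_smul, enorm_mul, Real.enorm_eq_ofReal NNReal.zero_le_coe,
            ENNReal.ofReal_coe_nnreal]
          calc s u * (‖fourier (χ n) u‖ₑ * ‖p u‖ₑ) ≤ s u * (1 * ‖p u‖ₑ) := by gcongr
            _ = _ := by simp
        calc ‖F n u‖ₑ ^ 2 / (s u : ℝ≥0∞) ≤ (s u * ‖p u‖ₑ) ^ 2 / (s u : ℝ≥0∞) := by gcongr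
          _ ≤ _ := by
            refine ENNReal.div_le_of_le_mul (le_of_eq ?_)
            ring
    _ = ∫⁻ u, ‖p u‖ₑ ^ 2 ∂(volume.withDensity fun u => (s u : ℝ≥0∞)) := by
        rw [lintegral_withDensity_eq_lintegral_mul _ hs.1.coe_nnreal_ennreal
          (by fun_prop)]
        rfl
    _ ≤ ∫⁻ u, ‖p u‖ₑ ^ 2 ∂N := by
        refine lintegral_mono' ?_ le_rfl
        rw [hN]; exact Measure.le_add_right le_rfl

end RandomMeasure

end Rigidity

namespace Rigidity

/-! ### Mixed finite differences. -/

variable {d : ℕ}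

/-- The multiplier of the mixed finite difference of order `k` and step `h`. -/
noncomputable def diffMultiplier (k : Fin d → ℕ) (h : ℝ) (u : E d) : ℂ :=
  ∏ j, (wave u (EuclideanSpace.single j h) - 1) ^ k j

/-- The coefficient of the translation by `h • i` in the finite difference of order `k`. -/
def diffCoeff (k i : Fin d → ℕ) : ℝ := ∏ j, (-1) ^ (k j - i j) * ((k j).choose (i j) : ℝ)

/-- The lattice vector `h • i`. -/
noncomputable def latticeVec (h : ℝ) (i : Fin d → ℕ) : E d :=
  ∑ j, (i j : ℝ) • EuclideanSpace.single j h

/-- The multi-indices `i ≤ k`. -/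
def multiIndexLE (k : Fin d → ℕ) : Finset (Fin d → ℕ) :=
  Fintype.piFinset fun j => Finset.range (k j + 1)

lemma wave_sum {ι : Type*} (t : Finset ι) (u : E d) (v : ι → E d) :
    wave u (∑ j ∈ t, v j) = ∏ j ∈ t, wave u (v j) := by
  classical
  induction t using Finset.induction_on with
  | empty => simp
  | insert a t ha ih => rw [Finset.sum_insert ha, Finset.prod_insert ha, wave_add_right, ih]

lemma wave_nsmul (n : ℕ) (u v : E d) : wave u ((n : ℝ) • v) = wave u v ^ n := by
  induction n with
  | zero => simp
  | succ n ih => rw [Nat.cast_succ, add_smul, one_smul, wave_add_right, ih, pow_succ]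

lemma diffMultiplier_eq_sum (k : Fin d → ℕ) (h : ℝ) (u : E d) :
    diffMultiplier k h u =
      ∑ i ∈ multiIndexLE k, (diffCoeff k i : ℂ) * wave u (latticeVec h i) := by
  have : ∀ j, (wave u (EuclideanSpace.single j h) - 1) ^ k j =
      ∑ m ∈ Finset.range (k j + 1), ((-1) ^ (k j - m) * ((k j).choose m : ℂ)) *
        wave u ((m : ℝ) • EuclideanSpace.single j h) := by
    intro j
    rw [sub_eq_add_neg, add_pow]
    refine Finset.sum_congr rfl fun m _ => ?_
    rw [wave_nsmul]; ring
  simp only [diffMultiplier, this, multiIndexLE]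
  rw [Finset.prod_univ_sum]
  refine Finset.sum_congr rfl fun i _ => ?_
  rw [Finset.prod_mul_distrib, latticeVec, wave_sum, diffCoeff]
  push_cast
  rfl

lemma latticeVec_apply (h : ℝ) (i : Fin d → ℕ) (j : Fin d) : latticeVec h i j = i j * h := by
  simp [latticeVec, Pi.single_apply]

lemma norm_latticeVec_le {k i : Fin d → ℕ} (hi : i ∈ multiIndexLE k) {h : ℝ} (hh : 0 ≤ h) :
    ‖latticeVec h i‖ ≤ h * ∑ j, (k j : ℝ) := by
  rw [latticeVec, Finset.mul_sum]
  refine norm_sum_le_of_le _ fun j _ => ?_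
  have : i j ≤ k j := by
    have := Fintype.mem_piFinset.1 hi j
    simp at this; omega
  rw [norm_smul, PiLp.norm_single, Real.norm_of_nonneg hh, mul_comm]
  gcongr
  simpa using this

/-- In each coordinate, the forward difference of order `k` lowers a monomial of the same degree to
the constant `k! h^k`, whatever the base point; the mixed difference is the product over
coordinates. -/
lemma sum_diffCoeff_mul_monomial (k : Fin d → ℕ) (h : ℝ) (z : E d) :
    ∑ i ∈ multiIndexLE k, diffCoeff k i * monomial k (z + latticeVec h i) =
      ∏ j, ((k j).factorial : ℝ) * h ^ k j := by
  have key : ∀ j, ∑ m ∈ Finset.range (k j + 1), (-1) ^ (k j - m) * ((k j).choose m : ℝ) *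
      (z j + m * h) ^ k j = (k j).factorial * h ^ k j := by
    intro j
    -- The unit-step identity is used at `z j / h`, so `h = 0` is separate; there the alternating
    -- sum of binomial coefficients decides.
    rcases eq_or_ne h 0 with rfl | hh
    · rcases Nat.eq_zero_or_pos (k j) with h0 | h0
      · simp [h0]
      · simp only [mul_zero, add_zero, zero_pow h0.ne', ← Finset.sum_mul]
        have := add_pow (1 : ℝ) (-1) (k j)
        simp only [add_neg_cancel, one_pow, one_mul, zero_pow h0.ne'] at this
        rw [← this, zero_mul]
    · have h1 := congrFun (fwdDiff_iter_eq_factorial (R := ℝ) (n := k j)) (z j / h)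
      rw [fwdDiff_iter_eq_sum_shift] at h1
      simp only [zsmul_eq_mul, nsmul_eq_mul, mul_one] at h1
      have h2 := congrArg (fun x => x * h ^ k j) h1
      simp only [Finset.sum_mul] at h2
      convert h2 using 1
      · refine Finset.sum_congr rfl fun m _ => ?_
        push_cast
        rw [mul_assoc, mul_assoc, mul_assoc, ← mul_pow]
        congr 3
        field_simp
      · simp
  rw [← Finset.prod_congr rfl fun j _ => key j, Finset.prod_univ_sum]
  refine Finset.sum_congr rfl fun i _ => ?_
  rw [diffCoeff, monomial, ← Finset.prod_mul_distrib]
  simp [latticeVec_apply]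

lemma continuous_diffMultiplier (k : Fin d → ℕ) (h : ℝ) : Continuous (diffMultiplier k h) := by
  unfold diffMultiplier; fun_prop

lemma norm_diffMultiplier_le (k : Fin d → ℕ) (h : ℝ) (u : E d) :
    ‖diffMultiplier k h u‖ ≤ ∏ j, (2 : ℝ) ^ k j := by
  rw [diffMultiplier, norm_prod]
  refine Finset.prod_le_prod (fun j _ => norm_nonneg _) fun j _ => ?_
  rw [norm_pow]
  gcongr
  refine (norm_sub_le _ _).trans ?_
  rw [norm_wave, norm_one]; norm_num

lemma norm_wave_single_sub_one_le (h : ℝ) (u : E d) (j : Fin d) :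
    ‖wave u (EuclideanSpace.single j h) - 1‖ ≤ |h| * |u j| := by
  refine (norm_wave_sub_one_le _ _).trans (le_of_eq ?_)
  rw [EuclideanSpace.inner_single_right, Real.norm_eq_abs, abs_mul]
  rfl

end Rigidity

namespace Rigidity

/-! ### The pairing with a finite difference, and the obstruction to rigidity of order `k`. -/

variable {d : ℕ}

/-- Parseval by Fubini and inversion for `χ`. The smoothness of `χ` supplies integrability in `u`,
since `f` is only bounded and measurable. -/
lemma integral_fourier_mul_conj {χ f : E d → ℝ} (hχ : ContDiff ℝ (⊤ : ℕ∞) χ)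
    (hχc : HasCompactSupport χ) (hf : IsCcb Set.univ f) (y : E d) :
    ∫ u, fourier χ u * wave u y * (starRingEnd ℂ) (fourier f u) =
      (2 * Real.pi) ^ d * ((∫ t, f t * χ (t - y) : ℝ) : ℂ) := by
  obtain ⟨hχi, hinv⟩ := fourier_inversion hχ hχc
  have hχ1 := (isCcb_of_continuous hχ.continuous hχc).integrable
  have hχm := (continuous_fourier hχ1).measurable
  have hfm := hf.measurable
  have e1 : ∀ u, fourier χ u * wave u y * (starRingEnd ℂ) (fourier f u) =
      ∫ t, fourier χ u * wave u y * ((starRingEnd ℂ) (wave u t) * (f t : ℂ)) := by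
    intro u
    rw [integral_const_mul, fourier_eq f, ← integral_conj]
    simp
  have hint : Integrable (Function.uncurry fun u t =>
      fourier χ u * wave u y * ((starRingEnd ℂ) (wave u t) * (f t : ℂ)))
      ((volume : Measure (E d)).prod volume) := by
    refine (hχi.mul_prod (hf.integrable.ofReal (𝕜 := ℂ))).mono ?_
      (Eventually.of_forall fun z => ?_)
    · have h1 : Measurable fun z : E d × E d => (starRingEnd ℂ) (wave z.1 z.2) :=
        Complex.continuous_conj.measurable.comp (by fun_prop)
      have : Measurable (Function.uncurry fun u t =>
          fourier χ u * wave u y * ((starRingEnd ℂ) (wave u t) * (f t : ℂ))) := by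
        unfold Function.uncurry; fun_prop
      exact this.aestronglyMeasurable
    · simp [Function.uncurry]
  simp only [e1]
  rw [integral_integral_swap hint, ← integral_complex_ofReal, ← integral_const_mul]
  congr 1; ext t
  have : ∀ u, fourier χ u * wave u y * ((starRingEnd ℂ) (wave u t) * (f t : ℂ)) =
      (starRingEnd ℂ) (wave u (t - y)) * fourier χ u * (f t : ℂ) := by
    intro u
    rw [sub_eq_add_neg, wave_add_right, wave_neg_right, map_mul, Complex.conj_conj]
    ring
  simp only [this]
  rw [integral_mul_const, hinv]
  push_cast
  ring

/-- `H` is a superposition of plane waves with `y ∈ B`. For one wave, Parseval turns the multiplier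
into a finite difference of `f` averaged against `χ`, at points where `f` is the monomial. The
result does not depend on `y`, so integrating it over the representation of `H` leaves the total
mass `H 0`. -/
lemma integral_fourier_mul_expType {χ f : E d → ℝ} (hχ : ContDiff ℝ (⊤ : ℕ∞) χ)
    (hχc : HasCompactSupport χ) (hχ1 : ∫ t, χ t = 1) {δ : ℝ}
    (hχs : tsupport χ ⊆ Metric.closedBall 0 δ) (hf : IsCcb Set.univ f) {B : Set (E d)} {H : E d → ℂ}
    (hH : HasExpType B H) (k : Fin d → ℕ) (h : ℝ)
    (hfk : ∀ y ∈ B, ∀ i ∈ multiIndexLE k, ∀ t, ‖t‖ ≤ δ →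
      f (t + (y + latticeVec h i)) = monomial k (t + (y + latticeVec h i))) :
    ∫ u, fourier χ u * (diffMultiplier k h u * H u) * (starRingEnd ℂ) (fourier f u) =
      (2 * Real.pi) ^ d * (∏ j, ((k j).factorial : ℝ) * h ^ k j : ℝ) * H 0 := by
  obtain ⟨hχi, -⟩ := fourier_inversion hχ hχc
  have hχint := (isCcb_of_continuous hχ.continuous hχc).integrable
  have hχm := (continuous_fourier hχint).measurable
  have hfc := continuous_fourier hf.integrable
  have hfm : Measurable fun u => (starRingEnd ℂ) (fourier f u) :=
    Complex.continuous_conj.measurable.comp hfc.measurable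
  have hdm := (continuous_diffMultiplier k h).measurable
  have inner_eq : ∀ y ∈ B, ∫ u, fourier χ u * diffMultiplier k h u * wave u y *
      (starRingEnd ℂ) (fourier f u) =
      (2 * Real.pi) ^ d * (∏ j, ((k j).factorial : ℝ) * h ^ k j : ℝ) := by
    intro y hy
    have e1 : ∀ u, fourier χ u * diffMultiplier k h u * wave u y *
        (starRingEnd ℂ) (fourier f u) = ∑ i ∈ multiIndexLE k, (diffCoeff k i : ℂ) *
          (fourier χ u * wave u (y + latticeVec h i) * (starRingEnd ℂ) (fourier f u)) := by
      intro u
      rw [diffMultiplier_eq_sum, Finset.mul_sum, Finset.sum_mul, Finset.sum_mul]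
      refine Finset.sum_congr rfl fun i _ => ?_
      rw [wave_add_right]; ring
    have i1 : ∀ v : E d, Integrable fun u =>
        fourier χ u * wave u v * (starRingEnd ℂ) (fourier f u) := by
      intro v
      refine (hχi.mul_const ((∫ t, |f t| : ℝ) : ℂ)).mono ?_ (Eventually.of_forall fun u => ?_)
      · have : Measurable fun u => fourier χ u * wave u v * (starRingEnd ℂ) (fourier f u) := by
          fun_prop
        exact this.aestronglyMeasurable
      · simp only [norm_mul, norm_wave, mul_one, RCLike.norm_conj, Complex.norm_real]
        gcongr
        exact (norm_fourier_le f u).trans (le_abs_self _)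
    simp only [e1]
    rw [integral_finsetSum _ fun i _ => (i1 _).const_mul _]
    simp only [integral_const_mul, integral_fourier_mul_conj hχ hχc hf]
    have e2 : ∀ i ∈ multiIndexLE k, ∫ t, f t * χ (t - (y + latticeVec h i)) =
        ∫ t, monomial k (t + y + latticeVec h i) * χ t := by
      intro i hi
      rw [← integral_add_right_eq_self _ (y + latticeVec h i)]
      congr 1; ext t
      rw [add_sub_cancel_right]
      by_cases ht : t ∈ Metric.closedBall (0 : E d) δ
      · rw [hfk y hy i hi t (by simpa using ht), add_assoc]
      · rw [image_eq_zero_of_notMem_tsupport (fun hh => ht (hχs hh)), mul_zero, mul_zero]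
    have e3 : ∑ i ∈ multiIndexLE k, diffCoeff k i * ∫ t, f t * χ (t - (y + latticeVec h i)) =
        ∏ j, ((k j).factorial : ℝ) * h ^ k j := by
      have i2 : ∀ i, Integrable fun t => monomial k (t + y + latticeVec h i) * χ t := by
        intro i
        refine Continuous.integrable_of_hasCompactSupport ?_ hχc.mul_left
        have := hχ.continuous
        unfold monomial
        fun_prop
      rw [Finset.sum_congr rfl fun i hi => by rw [e2 i hi, ← integral_const_mul],
        ← integral_finsetSum _ fun i _ => (i2 i).const_mul _]
      simp only [← mul_assoc, ← Finset.sum_mul, sum_diffCoeff_mul_monomial]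
      rw [integral_const_mul, hχ1, mul_one]
    rw [← e3, Complex.ofReal_sum, Finset.mul_sum]
    refine Finset.sum_congr rfl fun i _ => ?_
    push_cast; ring
  obtain ⟨X, _, μ, T, b, hμ, hT, hb, ⟨C, hC⟩, hTB, hHeq⟩ := hH
  have e1 : ∀ u, fourier χ u * (diffMultiplier k h u * H u) * (starRingEnd ℂ) (fourier f u) =
      ∫ x, fourier χ u * diffMultiplier k h u * wave u (T x) *
        (starRingEnd ℂ) (fourier f u) * b x ∂μ := by
    intro u
    rw [hHeq, ← integral_const_mul, ← integral_const_mul, ← integral_mul_const]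
    congr 1; ext x; ring
  have hint : Integrable (Function.uncurry fun u x => fourier χ u * diffMultiplier k h u *
      wave u (T x) * (starRingEnd ℂ) (fourier f u) * b x) (volume.prod μ) := by
    have hbi : Integrable b μ := Integrable.of_bound hb.aestronglyMeasurable C
      (Eventually.of_forall hC)
    refine ((hχi.const_mul (((∏ j, (2 : ℝ) ^ k j) * (∫ t, |f t|) : ℝ) : ℂ)).mul_prod hbi).mono ?_
      (Eventually.of_forall fun z => ?_)
    · have : Measurable (Function.uncurry fun u x => fourier χ u * diffMultiplier k h u *
          wave u (T x) * (starRingEnd ℂ) (fourier f u) * b x) := by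
        unfold Function.uncurry; fun_prop
      exact this.aestronglyMeasurable
    · simp only [Function.uncurry, norm_mul, norm_wave, mul_one, RCLike.norm_conj,
        Complex.norm_real]
      have h1 := norm_diffMultiplier_le k h z.1
      have h2 := norm_fourier_le f z.1
      have h3 : 0 ≤ ∏ j, (2 : ℝ) ^ k j := by positivity
      rw [Real.norm_of_nonneg h3, Real.norm_of_nonneg ((norm_nonneg _).trans h2)]
      calc _ ≤ ‖fourier χ z.1‖ * (∏ j, (2 : ℝ) ^ k j) * (∫ t, |f t|) * ‖b z.2‖ := by gcongr
        _ = _ := by ring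
  simp only [e1]
  rw [integral_integral_swap hint]
  simp only [integral_mul_const]
  rw [integral_congr_ae (Eventually.of_forall fun x => by
    simp only [inner_eq (T x) (hTB x)]; rfl), integral_const_mul, hHeq 0]
  simp

/-- Weighted Cauchy--Schwarz inequality. -/
lemma lintegral_mul_sq_le {X : Type*} [MeasurableSpace X] {μ : Measure X} {a b s : X → ℝ≥0∞}
    (ha : Measurable a) (hb : Measurable b) (hs : Measurable s) (hs' : ∀ x, s x ≠ ∞)
    (hfin : ∫⁻ x, a x ^ 2 / s x ∂μ < ∞) :
    (∫⁻ x, a x * b x ∂μ) ^ 2 ≤ (∫⁻ x, a x ^ 2 / s x ∂μ) * ∫⁻ x, s x * b x ^ 2 ∂μ := by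
  have h1 := ENNReal.lintegral_mul_le_Lp_mul_Lq μ (p := 2) (q := 2)
    (by rw [Real.holderConjugate_iff]; norm_num)
    (f := fun x => (a x ^ 2 / s x) ^ (1 / 2 : ℝ)) (g := fun x => (s x * b x ^ 2) ^ (1 / 2 : ℝ))
    (by fun_prop) (by fun_prop)
  have hsq : ∀ x : ℝ≥0∞, (x ^ (1 / 2 : ℝ)) ^ (2 : ℝ) = x := fun x => by
    rw [← ENNReal.rpow_mul]; norm_num
  simp only [hsq] at h1
  have h2 : ∫⁻ x, a x * b x ∂μ ≤ ∫⁻ x, ((fun x => (a x ^ 2 / s x) ^ (1 / 2 : ℝ)) *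
      fun x => (s x * b x ^ 2) ^ (1 / 2 : ℝ)) x ∂μ := by
    refine lintegral_mono_ae ?_
    filter_upwards [ae_lt_top (by fun_prop) hfin.ne] with x hx
    rw [Pi.mul_apply, ← ENNReal.mul_rpow_of_nonneg _ _ (by norm_num)]
    -- Where `s = 0`, finiteness of `a² / s` forces `a = 0`, since a non-zero value divided by `0`
    -- is `∞`.
    rcases eq_or_ne (s x) 0 with h0 | h0
    · have : a x = 0 := by
        by_contra hne
        rw [h0, ENNReal.div_zero (pow_ne_zero 2 hne)] at hx
        exact lt_irrefl _ hx
      simp [this]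
    · rw [← mul_assoc, ENNReal.div_mul_cancel h0 (hs' x), ← mul_pow, ← ENNReal.rpow_natCast,
        ← ENNReal.rpow_mul]
      norm_num
  calc _ ≤ ((∫⁻ x, a x ^ 2 / s x ∂μ) ^ (1 / 2 : ℝ) * (∫⁻ x, s x * b x ^ 2 ∂μ) ^ (1 / 2 : ℝ)) ^ 2 := by
        gcongr; exact h2.trans h1
    _ = _ := by
        rw [mul_pow, ← ENNReal.rpow_natCast, ← ENNReal.rpow_natCast]
        simp only [Nat.cast_ofNat, hsq]

lemma isCcb_indicator_monomial {D : Set (E d)} (hDm : MeasurableSet D)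
    (hDb : Bornology.IsBounded D) (k : Fin d → ℕ) :
    IsCcb Set.univ (D.indicator (monomial k)) := by
  have hc : Continuous (monomial k : E d → ℝ) := by unfold monomial; fun_prop
  obtain ⟨C, hC⟩ := hDb.isCompact_closure.exists_bound_of_continuousOn hc.continuousOn
  refine ⟨hc.measurable.indicator hDm, ⟨|C|, fun x => ?_⟩, ?_, Set.subset_univ _⟩
  · by_cases hx : x ∈ D
    · rw [Set.indicator_of_mem hx]
      exact (hC x (subset_closure hx)).trans (le_abs_self _)
    · rw [Set.indicator_of_notMem hx]; simp
  · refine HasCompactSupport.intro hDb.isCompact_closure fun x hx => ?_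
    exact Set.indicator_of_notMem (fun h => hx (subset_closure h)) _

/-- A function of exponential type which does not vanish at the origin, and which becomes square
integrable for the weight `1 / s` after multiplication with the multiplier of the finite difference
of order `k`, excludes rigidity of order `k`. -/
lemma RandomMeasure.not_linearlyRigidOfOrder {Ω : Type*} [MeasurableSpace Ω] {P : Measure Ω}
    {M : RandomMeasure d P} [IsProbabilityMeasure P] [NeZero d]
    (hM : M.IsWideSenseStationary) {s : E d → ℝ≥0} (hs : M.IsSpectralDensity s)
    {B D : Set (E d)} (hDm : MeasurableSet D) (hDb : Bornology.IsBounded D) {ρ : ℝ} (hρ : 0 < ρ)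
    (hBD : ∀ t ∈ B, ∀ x, ‖x‖ ≤ ρ → x + t ∈ D) {H : E d → ℂ} (hH : HasExpType B H) (hH0 : H 0 ≠ 0)
    (k : Fin d → ℕ)
    (hint : ∀ h : ℝ, ∫⁻ u, ‖diffMultiplier k h u * H u‖ₑ ^ 2 / (s u : ℝ≥0∞) < ∞) :
    ¬ M.LinearlyRigidOfOrder k D := by
  rintro ⟨f, hf, -, hlim⟩
  obtain ⟨N, ν, hMN, hν, hN⟩ := exists_isMomentMeasure hM hs
  set γ := D.indicator (monomial k) with hγ
  have hγc : IsCcb Set.univ γ := isCcb_indicator_monomial hDm hDb k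
  obtain ⟨χ, hχ, hχc, hχs, hχ1, hχb, -⟩ := exists_mollifier d (δ := ρ / 2) (by positivity)
  set K : ℝ := ∑ j, (k j : ℝ) with hK
  have hK0 : 0 ≤ K := Finset.sum_nonneg fun j _ => Nat.cast_nonneg _
  -- The lattice translations `h • i`, `i ≤ k`, use at most half of the margin `ρ`; the mollifier
  -- uses the other half. The `+ 1` covers `k = 0`.
  set h : ℝ := ρ / 2 / (K + 1) with hh
  have hh0 : 0 < h := by positivity
  have hhK : h * K ≤ ρ / 2 := by
    rw [hh, div_mul_eq_mul_div, div_le_iff₀ (by positivity)]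
    nlinarith
  set Q : E d → ℂ := fun u => diffMultiplier k h u * H u with hQ
  have hQm : Measurable Q :=
    ((continuous_diffMultiplier k h).mul hH.continuous).measurable
  set c : ℂ := (2 * Real.pi) ^ d * (∏ j, ((k j).factorial : ℝ) * h ^ k j : ℝ) * H 0 with hc
  have hc0 : c ≠ 0 := by
    have hπ : (Real.pi : ℂ) ≠ 0 := by exact_mod_cast Real.pi_ne_zero
    have hp : (∏ j, ((k j).factorial : ℝ) * h ^ k j) ≠ 0 :=
      Finset.prod_ne_zero_iff.2 fun j _ =>
        mul_ne_zero (by exact_mod_cast (k j).factorial_ne_zero) (pow_ne_zero _ hh0.ne')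
    exact mul_ne_zero (mul_ne_zero (pow_ne_zero _ (mul_ne_zero two_ne_zero hπ))
      (by exact_mod_cast hp)) hH0
  -- Since `f n` vanishes on `D`, the difference `γ - f n` equals `t^k` there. Its pairing is thus
  -- the constant `c` for every `n`, and weighted Cauchy–Schwarz bounds it by the `L²` error.
  have hbound : ∀ n, ‖c‖ₑ ^ 2 ≤ (∫⁻ u, ‖Q u‖ₑ ^ 2 / (s u : ℝ≥0∞)) *
      eLpNorm (M.I (f n) - M.I γ) 2 P ^ 2 := by
    intro n
    have hfn := (hf n).univ
    have hg : IsCcb Set.univ (γ - f n) := hγc.sub hfn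
    have hgm := (continuous_fourier hg.integrable).measurable
    have hval := integral_fourier_mul_expType hχ hχc hχ1 hχs hg hH k h (fun y hy i hi t ht => by
      have hmem : t + (y + latticeVec h i) ∈ D := by
        have : t + (y + latticeVec h i) = (t + latticeVec h i) + y := by abel
        rw [this]
        refine hBD y hy _ ((norm_add_le _ _).trans ?_)
        have := norm_latticeVec_le hi hh0.le
        linarith
      have h0 : f n (t + (y + latticeVec h i)) = 0 :=
        image_eq_zero_of_notMem_tsupport fun hts => (hf n).tsupport_subset hts hmem
      simp only [Pi.sub_apply, h0, sub_zero, hγ]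
      exact Set.indicator_of_mem hmem _)
    have h1 : ‖c‖ₑ ≤ ∫⁻ u, ‖Q u‖ₑ * ‖fourier (γ - f n) u‖ₑ := by
      rw [hc, ← hval]
      refine (enorm_integral_le_lintegral_enorm _).trans (lintegral_mono fun u => ?_)
      rw [enorm_mul, enorm_mul]
      have h2 : ‖fourier χ u‖ₑ ≤ 1 := by
        rw [← ofReal_norm, ENNReal.ofReal_le_one]; exact hχb u
      have h3 : ‖(starRingEnd ℂ) (fourier (γ - f n) u)‖ₑ = ‖fourier (γ - f n) u‖ₑ := by
        rw [← ofReal_norm, ← ofReal_norm, RCLike.norm_conj]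
      rw [h3]
      calc _ ≤ 1 * ‖Q u‖ₑ * ‖fourier (γ - f n) u‖ₑ := by gcongr
        _ = _ := by rw [one_mul]
    have h2 : ∫⁻ u, (s u : ℝ≥0∞) * ‖fourier (γ - f n) u‖ₑ ^ 2 ≤
        eLpNorm (M.I (f n) - M.I γ) 2 P ^ 2 := by
      have e1 : eLpNorm (M.I (f n) - M.I γ) 2 P ^ 2 = ∫⁻ ω, ‖M.I (γ - f n) ω‖ₑ ^ 2 ∂P := by
        rw [← neg_sub, eLpNorm_neg, ← eLpNorm_congr_ae (M.I_sub hγc hfn),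
          eLpNorm_eq_lintegral_rpow_enorm_toReal (by norm_num) (by norm_num),
          ← ENNReal.rpow_natCast, ← ENNReal.rpow_mul]
        norm_num
      rw [e1, hMN.lintegral_eq _ hg]
      calc _ = ∫⁻ u, ‖fourier (γ - f n) u‖ₑ ^ 2 ∂(volume.withDensity fun u => (s u : ℝ≥0∞)) := by
            rw [lintegral_withDensity_eq_lintegral_mul _ hs.1.coe_nnreal_ennreal
              (by fun_prop)]
            rfl
        _ ≤ _ := by
            refine lintegral_mono' ?_ le_rfl
            rw [hN]; exact Measure.le_add_right le_rfl
    calc ‖c‖ₑ ^ 2 ≤ (∫⁻ u, ‖Q u‖ₑ * ‖fourier (γ - f n) u‖ₑ) ^ 2 := by gcongr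
      _ ≤ _ := lintegral_mul_sq_le hQm.enorm hgm.enorm hs.1.coe_nnreal_ennreal
          (fun u => ENNReal.coe_ne_top) (hint h)
      _ ≤ _ := by gcongr
  have hlim2 : Tendsto (fun n => (∫⁻ u, ‖Q u‖ₑ ^ 2 / (s u : ℝ≥0∞)) *
      eLpNorm (M.I (f n) - M.I γ) 2 P ^ 2) atTop (𝓝 0) := by
    have h1 := ENNReal.Tendsto.pow (n := 2) hlim
    have h2 := ENNReal.Tendsto.const_mul (a := ∫⁻ u, ‖Q u‖ₑ ^ 2 / (s u : ℝ≥0∞)) h1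
      (Or.inr (hint h).ne)
    simpa using h2
  have h0 := ge_of_tendsto' hlim2 hbound
  rw [nonpos_iff_eq_zero, pow_eq_zero_iff two_ne_zero, enorm_eq_zero] at h0
  exact hc0 h0

end Rigidity

namespace Rigidity

/-! ### Averaging over the orthogonal group. -/

variable {V : Type} [NormedAddCommGroup V] [InnerProductSpace ℝ V] [FiniteDimensional ℝ V]

/-- The orthogonal group. -/
abbrev Orth (V : Type) [NormedAddCommGroup V] [InnerProductSpace ℝ V] [FiniteDimensional ℝ V] :
    Type := unitary (V →L[ℝ] V)

noncomputable instance : MeasurableSpace (Orth V) := borel _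

instance : BorelSpace (Orth V) := ⟨rfl⟩

/-- Unitary operators form a closed subset of the unit ball of a finite-dimensional space.
Compactness makes Haar measure finite. -/
instance : CompactSpace (Orth V) := by
  have : ProperSpace (V →L[ℝ] V) := FiniteDimensional.proper ℝ _
  apply isCompact_iff_compactSpace.1
  refine Metric.isCompact_of_isClosed_isBounded isClosed_unitary ?_
  refine (Metric.isBounded_closedBall (x := (0 : V →L[ℝ] V)) (r := 1)).subset fun f hf => ?_
  rw [mem_closedBall_zero_iff]
  refine ContinuousLinearMap.opNorm_le_bound _ zero_le_one fun x => ?_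
  have : ‖Unitary.linearIsometryEquiv (⟨f, hf⟩ : Orth V) x‖ = ‖x‖ :=
    LinearIsometryEquiv.norm_map _ x
  rw [one_mul]
  exact this.le

instance : SecondCountableTopology (Orth V) := by
  have : ProperSpace (V →L[ℝ] V) := FiniteDimensional.proper ℝ _
  infer_instance

/-- The action of an orthogonal map. -/
noncomputable def rot (g : Orth V) : V ≃ₗᵢ[ℝ] V := Unitary.linearIsometryEquiv g

lemma rot_mul (g h : Orth V) (u : V) : rot (g * h) u = rot g (rot h u) := by
  simp [rot]

lemma rot_one (u : V) : rot (1 : Orth V) u = u := by simp [rot]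

lemma wave_rot_inv (g : Orth V) (u t : V) : wave (rot g⁻¹ u) t = wave u (rot g t) := by
  have : rot g (rot g⁻¹ u) = u := by rw [← rot_mul, mul_inv_cancel, rot_one]
  rw [wave, wave, ← LinearIsometryEquiv.inner_map_map (rot g) (rot g⁻¹ u) t, this]

lemma continuous_rot : Continuous fun z : Orth V × V => rot z.1 z.2 := by
  have : (fun z : Orth V × V => rot z.1 z.2) = fun z => (z.1 : V →L[ℝ] V) z.2 := by
    ext z; rfl
  rw [this]
  fun_prop

lemma exists_rot_eq {u v : V} (h : ‖u‖ = ‖v‖) : ∃ g : Orth V, rot g u = v := by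
  refine ⟨Unitary.linearIsometryEquiv.symm (Submodule.reflection (ℝ ∙ (u - v))ᗮ), ?_⟩
  rw [rot, MulEquiv.apply_symm_apply]
  exact Submodule.reflection_sub h

/-- The average of a function over rotations. -/
noncomputable def rotAverage (F : V → ℂ) (u : V) : ℂ :=
  ∫ g : Orth V, F (rot g⁻¹ u) ∂Measure.haar

lemma rotAverage_eq_of_norm_eq (F : V → ℂ) {u v : V} (h : ‖u‖ = ‖v‖) :
    rotAverage F u = rotAverage F v := by
  obtain ⟨g, rfl⟩ := exists_rot_eq h
  rw [rotAverage, rotAverage, ← integral_mul_left_eq_self _ g⁻¹]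
  simp only [mul_inv_rev, inv_inv, rot_mul]

variable [MeasurableSpace V] [BorelSpace V]

/-- Rotating the frequency by `g⁻¹` amounts to rotating the carrier by `g`, which preserves centred
balls. -/
lemma HasExpType.rotAverage {r : ℝ} {F : V → ℂ} (h : HasExpType (Metric.closedBall 0 r) F) :
    HasExpType (Metric.closedBall 0 r) (rotAverage F) := by
  obtain ⟨X, _, μ, T, b, h1, h2, h3, ⟨C, h4⟩, h5, h6⟩ := h
  have hT' : Measurable fun z : X × Orth V => rot z.2 (T z.1) :=
    continuous_rot.measurable.comp (measurable_snd.prodMk (h2.comp measurable_fst))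
  refine ⟨X × Orth V, inferInstance, μ.prod Measure.haar, fun z => rot z.2 (T z.1),
    fun z => b z.1, inferInstance, hT', h3.comp measurable_fst, ⟨C, fun z => h4 _⟩,
    fun z => ?_, fun u => ?_⟩
  · have := h5 z.1
    simpa using this
  · rw [Rigidity.rotAverage]
    have hi : Integrable (fun z : X × Orth V => wave u (rot z.2 (T z.1)) * b z.1)
        (μ.prod Measure.haar) :=
      integrable_wave_mul (f := fun _ => u) (by fun_prop) hT' (h3.comp measurable_fst) fun z => h4 _
    rw [integral_prod_symm _ hi]
    congr 1; ext g
    rw [h6]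
    simp only [wave_rot_inv]

/-- Cauchy–Schwarz over the group, with `s` constant on orbits, then Tonelli and the rotation
invariance of Lebesgue measure. Haar measure is not assumed normalised, hence the factor `m
Set.univ`. -/
lemma lintegral_rotAverage_lt_top {F : V → ℂ} (hF : Continuous F) {s : V → ℝ≥0}
    (hs : Measurable s) (hiso : ∀ u v, ‖u‖ = ‖v‖ → s u = s v)
    (hfin : ∫⁻ u, ‖F u‖ₑ ^ 2 / (s u : ℝ≥0∞) < ∞) :
    ∫⁻ u, ‖rotAverage F u‖ₑ ^ 2 / (s u : ℝ≥0∞) < ∞ := by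
  set m : Measure (Orth V) := Measure.haar
  have hm : Measurable fun z : V × Orth V => ‖F (rot z.2⁻¹ z.1)‖ₑ := by
    have : Continuous fun z : V × Orth V => F (rot z.2⁻¹ z.1) :=
      hF.comp (continuous_rot.comp (continuous_snd.inv.prodMk continuous_fst))
    exact this.measurable.enorm
  have hms := hs.coe_nnreal_ennreal
  have h1 : ∀ u, ‖rotAverage F u‖ₑ ^ 2 / (s u : ℝ≥0∞) ≤
      ∫⁻ g, m Set.univ * (‖F (rot g⁻¹ u)‖ₑ ^ 2 / (s (rot g⁻¹ u) : ℝ≥0∞)) ∂m := by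
    intro u
    have hmu : Measurable fun g : Orth V => ‖F (rot g⁻¹ u)‖ₑ :=
      (hF.comp (continuous_rot.comp (continuous_inv.prodMk continuous_const))).measurable.enorm
    have h2 : ‖rotAverage F u‖ₑ ^ 2 ≤ (∫⁻ g, ‖F (rot g⁻¹ u)‖ₑ ^ 2 ∂m) * m Set.univ := by
      have := lintegral_mul_sq_le (μ := m) (b := fun _ => 1) (s := fun _ => 1)
        hmu measurable_const measurable_const (by simp)
      by_cases hfin : ∫⁻ g, ‖F (rot g⁻¹ u)‖ₑ ^ 2 ∂m < ∞
      · have := this (by simpa using hfin)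
        simp only [mul_one, div_one, one_pow, lintegral_one] at this
        refine le_trans ?_ this
        gcongr
        exact enorm_integral_le_lintegral_enorm _
      · rw [not_lt, top_le_iff] at hfin
        rw [hfin, ENNReal.top_mul]
        · exact le_top
        · exact (Measure.measure_univ_pos.2 (NeZero.ne m)).ne'
    have h3 : ∀ g : Orth V, s (rot g⁻¹ u) = s u := fun g => hiso _ _ (by simp)
    simp only [h3]
    rw [lintegral_const_mul _ (by fun_prop)]
    simp only [div_eq_mul_inv]
    rw [lintegral_mul_const _ (by fun_prop), ← mul_assoc]
    gcongr
    rw [mul_comm]; exact h2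
  refine (lintegral_mono h1).trans_lt ?_
  rw [lintegral_lintegral_swap]
  · have h4 : ∀ g : Orth V, ∫⁻ u, m Set.univ * (‖F (rot g⁻¹ u)‖ₑ ^ 2 /
        (s (rot g⁻¹ u) : ℝ≥0∞)) = m Set.univ * ∫⁻ u, ‖F u‖ₑ ^ 2 / (s u : ℝ≥0∞) := by
      intro g
      have hmeas : Measurable fun u => m Set.univ * (‖F u‖ₑ ^ 2 / (s u : ℝ≥0∞)) := by
        have := hF.measurable
        fun_prop
      have hmp := (rot g⁻¹).measurePreserving
      rw [hmp.lintegral_comp hmeas, lintegral_const_mul _ (by fun_prop)]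
    simp only [h4, lintegral_const]
    exact ENNReal.mul_lt_top (ENNReal.mul_lt_top (measure_lt_top _ _) hfin) (measure_lt_top _ _)
  · have h5 : Measurable fun z : V × Orth V => (s (rot z.2⁻¹ z.1) : ℝ≥0∞) := by
      have : Continuous fun z : V × Orth V => rot z.2⁻¹ z.1 :=
        continuous_rot.comp (continuous_snd.inv.prodMk continuous_fst)
      exact hms.comp this.measurable
    exact (((hm.pow_const 2).div h5).const_mul _).aemeasurable

/-- A small modulation makes the rotation average non-zero. -/
lemma exists_rotAverage_ne_zero {B : Set (V)} {F : V → ℂ} (h : HasExpType B F) {u : V}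
    (hu : F u ≠ 0) {ε : ℝ} (hε : 0 < ε) :
    ∃ y : V, ‖y‖ ≤ ε ∧ rotAverage (fun v => wave v y * F v) u ≠ 0 := by
  by_contra hcon
  push Not at hcon
  apply hu
  have hFc := h.continuous
  obtain ⟨A, hA⟩ := h.exists_bound
  obtain ⟨X, _, μ, T, b, h1, h2, h3, ⟨C, h4⟩, h5, h6⟩ := h
  set m : Measure (Orth V) := Measure.haar
  have hrc : Continuous fun g : Orth V => rot g⁻¹ u :=
    continuous_rot.comp (continuous_inv.prodMk continuous_const)
  have hrm := hrc.measurable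
  -- As a function of the modulation `y`, the average is again of exponential type, with frequencies
  -- of norm `‖u‖` as carrier. Vanishing for small `y`, it vanishes for all `y`.
  set Ψ : V → ℂ := fun y => ∫ g, wave y (rot g⁻¹ u) * F (rot g⁻¹ u) ∂m with hΨ
  have hΨt : HasExpType (Metric.closedBall 0 ‖u‖) Ψ :=
    ⟨Orth V, inferInstance, m, fun g => rot g⁻¹ u, fun g => F (rot g⁻¹ u), inferInstance, hrm,
      (hFc.comp hrc).measurable, ⟨A, fun g => hA _⟩, fun g => by simp, fun y => rfl⟩
  have hΨs : ∀ y, ‖y‖ ≤ ε → Ψ y = 0 := fun y hy => by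
    rw [← hcon y hy, hΨ, Rigidity.rotAverage]
    simp only [wave_comm y]
    rfl
  have hΨ0 : ∀ y, Ψ y = 0 := by
    intro y
    refine hΨt.eq_zero_of_isBigO Metric.isBounded_closedBall y fun n => ?_
    have hev : ∀ᶠ x : ℝ in 𝓝 0, Ψ (x • y) = 0 := by
      have hc : Continuous fun x : ℝ => ‖x • y‖ := by fun_prop
      have : ∀ᶠ x : ℝ in 𝓝 0, ‖x • y‖ < ε := hc.continuousAt.eventually_lt_const (by simpa using hε)
      filter_upwards [this] with x hx using hΨs _ hx.le
    exact (Asymptotics.isBigO_zero _ _).congr' (hev.mono fun x hx => hx.symm) EventuallyEq.rfl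
  -- The conjugate factor is a superposition of plane waves, against each of which the integral is a
  -- value of `Ψ`. So `F` vanishes on the orbit of `u`, in particular at `g = 1`.
  have key : ∫ g, F (rot g⁻¹ u) * (starRingEnd ℂ) (F (rot g⁻¹ u)) ∂m = 0 := by
    have e1 : ∀ g : Orth V, F (rot g⁻¹ u) * (starRingEnd ℂ) (F (rot g⁻¹ u)) =
        ∫ x, wave (-T x) (rot g⁻¹ u) * F (rot g⁻¹ u) * (starRingEnd ℂ) (b x) ∂μ := by
      intro g
      nth_rw 2 [h6]
      rw [← integral_conj, ← integral_const_mul]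
      congr 1; ext x
      rw [map_mul, wave_neg_left, wave_comm]; ring
    simp only [e1]
    rw [integral_integral_swap]
    · simp only [integral_mul_const]
      have : ∀ x, ∫ g, wave (-T x) (rot g⁻¹ u) * F (rot g⁻¹ u) ∂m = 0 := fun x => hΨ0 _
      simp [this]
    · have hF' : Measurable fun g : Orth V => F (rot g⁻¹ u) := (hFc.comp hrc).measurable
      have hb' : Measurable fun x => (starRingEnd ℂ) (b x) :=
        Complex.continuous_conj.measurable.comp h3
      refine Integrable.of_bound (C := A * C) ?_ (Eventually.of_forall fun z => ?_)
      · have : Measurable (Function.uncurry fun (g : Orth V) x =>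
            wave (-T x) (rot g⁻¹ u) * F (rot g⁻¹ u) * (starRingEnd ℂ) (b x)) := by
          unfold Function.uncurry
          exact ((Measurable.wave (by fun_prop) (hrm.comp measurable_fst)).mul
            (hF'.comp measurable_fst)).mul (hb'.comp measurable_snd)
        exact this.aestronglyMeasurable
      · have hA0 : 0 ≤ A := (norm_nonneg _).trans (hA 0)
        simp only [Function.uncurry, norm_mul, norm_wave, one_mul, RCLike.norm_conj]
        gcongr
        · exact hA _
        · exact h4 _
  have e2 : ∀ g : Orth V, F (rot g⁻¹ u) * (starRingEnd ℂ) (F (rot g⁻¹ u)) =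
      ((‖F (rot g⁻¹ u)‖ ^ 2 : ℝ) : ℂ) := fun g => by
    rw [Complex.mul_conj, Complex.normSq_eq_norm_sq]
  simp only [e2] at key
  rw [integral_complex_ofReal, Complex.ofReal_eq_zero] at key
  have hcont : Continuous fun g : Orth V => ‖F (rot g⁻¹ u)‖ ^ 2 := (hFc.comp hrc).norm.pow 2
  rw [integral_eq_zero_iff_of_nonneg (fun g => by positivity)
    (hcont.integrable_of_hasCompactSupport (HasCompactSupport.of_compactSpace _))] at key
  have := congrFun ((Continuous.ae_eq_iff_eq m hcont (g := 0) continuous_zero).1 key) 1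
  simpa [rot_one] using this

end Rigidity

namespace Rigidity

/-! ### Differentiation along lines. -/

section Line

variable {V : Type*} [NormedAddCommGroup V] [InnerProductSpace ℝ V] [MeasurableSpace V]

/-- It is enough to bound the carrier and the density almost everywhere. -/
lemma HasExpType.of_ae {B : Set V} (hB : MeasurableSet B) {t₀ : V} (ht₀ : t₀ ∈ B) {F : V → ℂ}
    {X : Type} [MeasurableSpace X] {μ : Measure X} [IsFiniteMeasure μ] {T : X → V} {b : X → ℂ}
    (hT : Measurable T) (hb : Measurable b) {C : ℝ} (hC : ∀ᵐ x ∂μ, ‖b x‖ ≤ C)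
    (hTB : ∀ᵐ x ∂μ, T x ∈ B) (hF : ∀ u, F u = ∫ x, wave u (T x) * b x ∂μ) : HasExpType B F := by
  classical
  refine ⟨X, inferInstance, μ, fun x => if T x ∈ B then T x else t₀,
    fun x => if ‖b x‖ ≤ C then b x else 0, inferInstance,
    Measurable.ite (hT hB) hT measurable_const,
    Measurable.ite (measurableSet_le hb.norm measurable_const) hb measurable_const,
    ⟨|C|, fun x => ?_⟩, fun x => ?_, fun u => ?_⟩
  · dsimp only
    split_ifs with h
    · exact h.trans (le_abs_self C)
    · simp
  · dsimp only
    split_ifs with h <;> assumption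
  · rw [hF]
    refine integral_congr_ae ?_
    filter_upwards [hC, hTB] with x h1 h2
    simp [h1, h2]

variable [BorelSpace V] [SecondCountableTopology V]

/-- A directional derivative multiplies the density by `-i⟨e, T⟩`, bounded on a bounded carrier;
derivatives are thus of the same type with the same carrier. -/
lemma hasDerivAt_integral_wave_line {X : Type*} [MeasurableSpace X] {μ : Measure X}
    [IsFiniteMeasure μ] {T : X → V} {b : X → ℂ} (hT : Measurable T) (hb : Measurable b) {r C : ℝ}
    (hr : ∀ x, ‖T x‖ ≤ r) (hC : ∀ x, ‖b x‖ ≤ C) (v e : V) (y : ℝ) :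
    HasDerivAt (fun y : ℝ => ∫ x, wave (v + y • e) (T x) * b x ∂μ)
      (∫ x, wave (v + y • e) (T x) * (-(Complex.I * (inner ℝ e (T x) : ℝ)) * b x) ∂μ) y := by
  refine (hasDerivAt_integral_of_dominated_loc_of_deriv_le (μ := μ)
    (F := fun y x => wave (v + y • e) (T x) * b x)
    (F' := fun (y : ℝ) x => wave (v + y • e) (T x) * (-(Complex.I * (inner ℝ e (T x) : ℝ)) * b x))
    (s := Set.univ) (bound := fun _ => ‖e‖ * r * C)
    univ_mem (Eventually.of_forall fun y => by fun_prop)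
    (integrable_wave_mul (f := fun _ => v + y • e) (by fun_prop) hT hb hC) (by fun_prop)
    (Eventually.of_forall fun x y _ => ?_) (integrable_const _)
    (Eventually.of_forall fun x y _ => ?_)).2
  · have h0 := (norm_nonneg _).trans (hr x)
    simp only [norm_mul, norm_wave, one_mul, norm_neg, Complex.norm_I, Complex.norm_real]
    gcongr
    · exact (norm_inner_le_norm _ _).trans (by gcongr; exact hr x)
    · exact hC x
  · have h1 : HasDerivAt (fun y : ℝ => inner ℝ (v + y • e) (T x)) (inner ℝ e (T x)) y := by
      simp only [inner_add_left, real_inner_smul_left]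
      simpa using ((hasDerivAt_id y).mul_const (inner ℝ e (T x))).const_add (inner ℝ v (T x))
    have h2 := ((h1.ofReal_comp.const_mul Complex.I).neg.cexp).mul_const (b x)
    refine h2.congr_deriv ?_
    rw [wave, Pi.neg_apply]; ring

end Line

/-! ### Division of radial functions by powers of `‖u‖²`. -/

section Radial

variable {V : Type} [NormedAddCommGroup V] [InnerProductSpace ℝ V]

/-- The partial dilation by `τ` in the direction of the unit vector `e`. -/
noncomputable def partialDilation (e : V) (τ : ℝ) (v : V) : V := v + ((τ - 1) * inner ℝ v e) • e

lemma inner_partialDilation (e : V) (τ : ℝ) (u v : V) :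
    (inner ℝ (partialDilation e τ u) v : ℝ) = inner ℝ u (partialDilation e τ v) := by
  simp only [partialDilation, inner_add_left, inner_add_right,
    real_inner_smul_right, real_inner_comm]
  ring

lemma norm_partialDilation_le {e : V} (he : ‖e‖ = 1) {τ : ℝ} (hτ : τ ∈ Set.Icc (0 : ℝ) 1) (v : V) :
    ‖partialDilation e τ v‖ ≤ ‖v‖ := by
  have hee : inner ℝ e e = (1 : ℝ) := by rw [real_inner_self_eq_norm_sq, he]; norm_num
  have : ‖partialDilation e τ v‖ ^ 2 ≤ ‖v‖ ^ 2 := by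
    rw [← real_inner_self_eq_norm_sq, ← real_inner_self_eq_norm_sq]
    simp only [partialDilation, inner_add_left, inner_add_right, real_inner_smul_left,
      real_inner_smul_right, real_inner_comm e v, hee]
    have h1 : 0 ≤ (1 - τ ^ 2) * (inner ℝ v e) ^ 2 := by
      have := hτ.1; have := hτ.2
      have : τ ^ 2 ≤ 1 := by nlinarith
      have := sq_nonneg (inner ℝ v e : ℝ)
      nlinarith
    rw [real_inner_comm v e] at *
    nlinarith
  exact le_of_sq_le_sq this (norm_nonneg _)

lemma partialDilation_eq (e : V) (τ : ℝ) (v : V) :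
    partialDilation e τ v = partialDilation e 0 v + (τ * inner ℝ v e) • e := by
  simp only [partialDilation, add_assoc, ← add_smul]
  congr 2; ring

variable [FiniteDimensional ℝ V] [MeasurableSpace V] [BorelSpace V]

/-- A radial function of exponential type which vanishes at the origin is divisible by `‖u‖²`. -/
lemma HasExpType.exists_eq_norm_sq_mul [Nontrivial V] {r : ℝ} {F : V → ℂ}
    (h : HasExpType (Metric.closedBall 0 r) F) (hrad : ∀ u v, ‖u‖ = ‖v‖ → F u = F v)
    (h0 : F 0 = 0) : ∃ G : V → ℂ, HasExpType (Metric.closedBall 0 r) G ∧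
      (∀ u v, ‖u‖ = ‖v‖ → G u = G v) ∧ ∀ u, F u = (‖u‖ : ℂ) ^ 2 * G u := by
  obtain ⟨e, he⟩ := exists_norm_eq V zero_le_one
  have hee : inner ℝ e e = (1 : ℝ) := by rw [real_inner_self_eq_norm_sq, he]; norm_num
  have hFc := h.continuous
  obtain ⟨X, _, μ, T, b, hμ, hT, hb, ⟨C, hC⟩, hTB, hF⟩ := h
  have hTr : ∀ x, ‖T x‖ ≤ r := fun x => by simpa using hTB x
  -- With an empty index space `r` may be negative; a point of `X` is what yields `0 ≤ r`.
  by_cases hX : IsEmpty X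
  · have hF0 : ∀ u, F u = 0 := fun u => by rw [hF]; simp [Measure.eq_zero_of_isEmpty μ]
    refine ⟨fun _ => 0, ⟨X, _, μ, T, b, hμ, hT, hb, ⟨C, hC⟩, hTB, fun u => ?_⟩, fun _ _ _ => rfl,
      fun u => by simp [hF0]⟩
    simp [Measure.eq_zero_of_isEmpty μ]
  rw [not_isEmpty_iff] at hX
  obtain ⟨x₀⟩ := hX
  have hr0 : 0 ≤ r := (norm_nonneg _).trans (hTr x₀)
  have hC0 : 0 ≤ C := (norm_nonneg _).trans (hC x₀)
  set a : X → ℂ := fun x => -(Complex.I * (inner ℝ e (T x) : ℝ)) with ha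
  have ham : Measurable a := by
    have : Measurable fun x => (inner ℝ e (T x) : ℝ) := by fun_prop
    fun_prop
  have har : ∀ x, ‖a x‖ ≤ r := fun x => by
    simp only [ha, norm_neg, norm_mul, Complex.norm_I, one_mul, Complex.norm_real]
    exact (norm_inner_le_norm _ _).trans (by rw [he, one_mul]; exact hTr x)
  have hab : ∀ x, ‖a x * b x‖ ≤ r * C := fun x => by
    rw [norm_mul]; gcongr; exacts [har x, hC x]
  have haab : ∀ x, ‖a x * (a x * b x)‖ ≤ r * (r * C) := fun x => by
    rw [norm_mul]; gcongr; exacts [har x, hab x]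
  set D : V → ℂ := fun v => ∫ x, wave v (T x) * (a x * b x) ∂μ with hD
  set D2 : V → ℂ := fun v => ∫ x, wave v (T x) * (a x * (a x * b x)) ∂μ with hD2
  have hD2c : Continuous D2 := HasExpType.continuous (B := Metric.closedBall 0 r)
    ⟨X, _, μ, T, fun x => a x * (a x * b x), hμ, hT, by fun_prop, ⟨_, haab⟩, hTB, fun _ => rfl⟩
  have hderiv : ∀ v y, HasDerivAt (fun y : ℝ => F (v + y • e)) (D (v + y • e)) y := by
    intro v y
    rw [funext fun y : ℝ => hF (v + y • e)]
    exact hasDerivAt_integral_wave_line hT hb hTr hC v e y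
  have hderiv2 : ∀ v y, HasDerivAt (fun y : ℝ => D (v + y • e)) (D2 (v + y • e)) y := fun v y =>
    hasDerivAt_integral_wave_line hT (by fun_prop) hTr hab v e y
  have hL : ∀ v, Continuous fun τ => partialDilation e τ v := fun v => by
    unfold partialDilation; fun_prop
  -- the derivative in the direction `e` vanishes on the hyperplane orthogonal to `e`
  have hDzero : ∀ v, D (partialDilation e 0 v) = 0 := by
    intro v
    set v₀ := partialDilation e 0 v with hv₀
    have hv₀e : inner ℝ v₀ e = (0 : ℝ) := by
      simp only [hv₀, partialDilation, inner_add_left, real_inner_smul_left, hee]; ring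
    have h1 := hderiv v₀ 0
    have h2 : HasDerivAt (fun y : ℝ => F (v₀ + y • e)) (-D (v₀ + (0 : ℝ) • e)) 0 := by
      have h3 := (hderiv v₀ (-0)).scomp (0 : ℝ) (hasDerivAt_neg (0 : ℝ))
      simp only [neg_zero, neg_smul, one_smul] at h3
      refine h3.congr_of_eventuallyEq (Eventually.of_forall fun y => ?_)
      refine hrad _ _ ?_
      have e1 : ‖v₀ + y • e‖ ^ 2 = ‖v₀ + (-y) • e‖ ^ 2 := by
        rw [norm_add_sq_real, norm_add_sq_real, real_inner_smul_right, real_inner_smul_right, hv₀e,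
          norm_smul, norm_smul, norm_neg]
        ring
      exact (sq_eq_sq₀ (norm_nonneg _) (norm_nonneg _)).1 e1
    have h4 := h1.unique h2
    rw [zero_smul, add_zero] at h4
    exact self_eq_neg.1 h4
  -- `D` vanishes on the hyperplane `e^⊥`, so integrating its `e`-derivative from there to `v` gives
  -- `D v = ⟨v, e⟩ G₁ v`.
  set G₁ : V → ℂ := fun v => ∫ τ in (0 : ℝ)..1, D2 (partialDilation e τ v) with hG₁
  have hDG : ∀ v, D v = (inner ℝ v e : ℝ) * G₁ v := by
    intro v
    set c : ℝ := inner ℝ v e with hc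
    have h1 : ∀ τ ∈ Set.uIcc (0 : ℝ) 1, HasDerivAt (fun τ : ℝ => D (partialDilation e τ v))
        ((c : ℂ) * D2 (partialDilation e τ v)) τ := by
      intro τ _
      have h2 := (hderiv2 (partialDilation e 0 v) (τ * c)).scomp τ
        ((hasDerivAt_id τ).mul_const c)
      simp only [one_mul] at h2
      rw [partialDilation_eq e τ v]
      refine (h2.congr_of_eventuallyEq (Eventually.of_forall fun y => ?_)).congr_deriv ?_
      · simp only [Function.comp, id]
        rw [partialDilation_eq e y v]
      · rw [Complex.real_smul]
    have h3 := intervalIntegral.integral_eq_sub_of_hasDerivAt h1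
      (((hD2c.comp (hL v)).const_smul (c : ℂ)).intervalIntegrable 0 1)
    rw [hDzero, sub_zero, intervalIntegral.integral_const_mul] at h3
    rw [h3]
    congr 1
    simp [partialDilation]
  -- radial profile
  have hprof : ∀ v, F v = F (‖v‖ • e) := fun v => hrad _ _ (by simp [norm_smul, he])
  have hf' : ∀ y, HasDerivAt (fun y : ℝ => F (y • e)) (D (y • e)) y := by
    intro y
    simpa using hderiv 0 y
  -- The `e`-derivative of `F` is computed twice: through the radial profile it is `(⟨v, e⟩ / ‖v‖)
  -- D(‖v‖ e)`, and directly it is `⟨v, e⟩ G₁ v`.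
  have hG₁rad : ∀ v, inner ℝ v e ≠ (0 : ℝ) → D (‖v‖ • e) = ‖v‖ * G₁ v := by
    intro v hv
    have hv0 : v ≠ 0 := fun h => hv (by simp [h])
    have hvn : 0 < ‖v‖ := norm_pos_iff.2 hv0
    set c : ℝ := inner ℝ v e with hc
    have h1 : HasDerivAt (fun y : ℝ => ‖v + y • e‖ ^ 2) (2 * c) 0 := by
      have e1 : (fun y : ℝ => ‖v + y • e‖ ^ 2) = fun y => ‖v‖ ^ 2 + 2 * c * y + y ^ 2 := by
        ext y
        rw [norm_add_sq_real, real_inner_smul_right, norm_smul, he, mul_one, Real.norm_eq_abs,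
          sq_abs]
        ring
      rw [e1]
      have := (((hasDerivAt_id (0 : ℝ)).const_mul (2 * c)).const_add (‖v‖ ^ 2)).add
        ((hasDerivAt_id (0 : ℝ)).pow 2)
      exact HasDerivAt.congr_deriv this (by simp)
    have h2 : HasDerivAt (fun y : ℝ => ‖v + y • e‖) (c / ‖v‖) 0 := by
      have h3 := h1.sqrt (by simpa using hv0)
      simp only [Real.sqrt_sq (norm_nonneg _), zero_smul, add_zero] at h3
      refine h3.congr_deriv ?_
      field_simp
    have h4 : HasDerivAt (fun y : ℝ => F (v + y • e)) ((c / ‖v‖ : ℝ) • D (‖v‖ • e)) 0 := by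
      have h5 : HasDerivAt (fun y : ℝ => F (y • e)) (D (‖v‖ • e)) ‖v + (0 : ℝ) • e‖ := by
        simpa using hf' ‖v‖
      have h6 := h5.scomp (0 : ℝ) h2
      exact h6.congr_of_eventuallyEq (Eventually.of_forall fun y => hprof _)
    have h7 := h4.unique (hderiv v 0)
    rw [zero_smul, add_zero, hDG v, Complex.real_smul] at h7
    have hcc : (c : ℂ) ≠ 0 := by exact_mod_cast hv
    have hvc : (‖v‖ : ℂ) ≠ 0 := by exact_mod_cast hvn.ne'
    push_cast at h7
    field_simp at h7
    rw [← hc] at h7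
    exact mul_left_cancel₀ hcc (by rw [h7]; ring)
  -- The derivative of `F(τ ‖u‖ e)` in `τ` is `‖u‖ D(τ ‖u‖ e) = ‖u‖² τ G₁(τ u)`; integrating over
  -- `[0, 1]` produces the quotient.
  set G : V → ℂ := fun u => ∫ τ in (0 : ℝ)..1, (τ : ℂ) * G₁ (τ • u) with hG
  have hGtype : HasExpType (Metric.closedBall 0 r) G := by
    set ι : Measure ℝ := volume.restrict (Set.Ioc 0 1) with hι
    have hιae : ∀ᵐ τ ∂ι, τ ∈ Set.Icc (0 : ℝ) 1 := by
      filter_upwards [ae_restrict_mem measurableSet_Ioc] with τ hτ using ⟨hτ.1.le, hτ.2⟩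
    have hfst : ∀ᵐ z ∂(ι.prod (ι.prod μ)), z.1 ∈ Set.Icc (0 : ℝ) 1 :=
      Measure.quasiMeasurePreserving_fst.ae hιae
    have hsnd : ∀ᵐ z ∂(ι.prod (ι.prod μ)), z.2.1 ∈ Set.Icc (0 : ℝ) 1 :=
      Measure.quasiMeasurePreserving_snd.ae (Measure.quasiMeasurePreserving_fst.ae hιae)
    have hT' : Measurable fun z : ℝ × ℝ × X => z.1 • partialDilation e z.2.1 (T z.2.2) := by
      unfold partialDilation; fun_prop
    have hb' : Measurable fun z : ℝ × ℝ × X => (z.1 : ℂ) * (a z.2.2 * (a z.2.2 * b z.2.2)) := by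
      fun_prop
    have hbC : ∀ᵐ z ∂(ι.prod (ι.prod μ)),
        ‖(z.1 : ℂ) * (a z.2.2 * (a z.2.2 * b z.2.2))‖ ≤ 1 * (r * (r * C)) := by
      filter_upwards [hfst] with z hz
      rw [norm_mul]
      gcongr
      · rw [Complex.norm_real, Real.norm_of_nonneg hz.1]; exact hz.2
      · exact haab _
    refine HasExpType.of_ae (μ := ι.prod (ι.prod μ)) Metric.isClosed_closedBall.measurableSet
      (Metric.mem_closedBall_self hr0) hT' hb' hbC ?_ fun u => ?_
    · filter_upwards [hfst, hsnd] with z h1 h2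
      rw [mem_closedBall_zero_iff, norm_smul, Real.norm_of_nonneg h1.1]
      calc z.1 * ‖partialDilation e z.2.1 (T z.2.2)‖ ≤ 1 * r := by
            gcongr
            · exact h1.2
            · exact (norm_partialDilation_le he h2 _).trans (hTr _)
        _ = r := one_mul r
    · have hint : Integrable (fun z : ℝ × ℝ × X =>
          wave u (z.1 • partialDilation e z.2.1 (T z.2.2)) *
            ((z.1 : ℂ) * (a z.2.2 * (a z.2.2 * b z.2.2)))) (ι.prod (ι.prod μ)) := by
        refine Integrable.of_bound (by fun_prop) (1 * (r * (r * C))) ?_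
        filter_upwards [hbC] with z hz
        rw [norm_mul, norm_wave, one_mul]; exact hz
      rw [integral_prod _ hint]
      simp only [hG, hG₁, intervalIntegral.integral_of_le zero_le_one]
      refine integral_congr_ae ?_
      filter_upwards [hint.prod_right_ae] with τ hτ
      rw [integral_prod _ hτ, ← integral_const_mul]
      congr 1; ext τ'
      simp only [hD2]
      rw [← integral_const_mul]
      congr 1; ext x
      -- Both dilations are self-adjoint and pass to the carrier point, where they are contractions;
      -- the ball is not enlarged.
      have : wave (partialDilation e τ' (τ • u)) (T x) = wave u (τ • partialDilation e τ' (T x)) := by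
        rw [← wave_smul_left, wave, wave, inner_partialDilation]
      rw [this]; ring
  have hGc := hGtype.continuous
  have hmain : ∀ u, inner ℝ u e ≠ (0 : ℝ) → F u = (‖u‖ : ℂ) ^ 2 * G u := by
    intro u hu
    have h1 : ∀ τ ∈ Set.uIcc (0 : ℝ) 1, HasDerivAt (fun τ : ℝ => F ((τ * ‖u‖) • e))
        ((‖u‖ : ℂ) ^ 2 * ((τ : ℂ) * G₁ (τ • u))) τ := by
      intro τ hτ
      rw [Set.uIcc_of_le zero_le_one] at hτ
      have h2 := (hf' (τ * ‖u‖)).scomp τ ((hasDerivAt_id τ).mul_const ‖u‖)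
      refine h2.congr_deriv ?_
      rw [one_mul, Complex.real_smul]
      rcases hτ.1.eq_or_lt with h3 | h3
      · rw [← h3, zero_mul, zero_smul, hDG]; simp
      · have h4 := hG₁rad (τ • u) (by
          rw [real_inner_smul_left]; exact mul_ne_zero h3.ne' hu)
        rw [norm_smul, Real.norm_of_nonneg hτ.1] at h4
        rw [h4]; push_cast; ring
    have hG₁c : Continuous fun τ : ℝ => (τ : ℂ) * G₁ (τ • u) := by
      have h5 : Continuous fun p : ℝ × ℝ => D2 (partialDilation e p.2 (p.1 • u)) := by
        refine hD2c.comp ?_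
        unfold partialDilation; fun_prop
      have h6 : Continuous fun τ : ℝ => G₁ (τ • u) :=
        intervalIntegral.continuous_parametric_intervalIntegral_of_continuous' h5 0 1
      exact Complex.continuous_ofReal.mul h6
    have h7 := intervalIntegral.integral_eq_sub_of_hasDerivAt h1
      ((hG₁c.const_smul ((‖u‖ : ℂ) ^ 2)).intervalIntegrable 0 1)
    rw [intervalIntegral.integral_const_mul, zero_mul, zero_smul, h0, sub_zero, one_mul,
      ← hprof] at h7
    exact h7.symm
  have hall : ∀ u, F u = (‖u‖ : ℂ) ^ 2 * G u := by
    intro u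
    -- On the hyperplane `e^⊥` the identity follows by continuity, approaching in the direction `e`.
    by_cases hu : inner ℝ u e = (0 : ℝ)
    · have hev : (fun y : ℝ => F (u + y • e)) =ᶠ[𝓝[≠] 0]
          fun y => (‖u + y • e‖ : ℂ) ^ 2 * G (u + y • e) := by
        filter_upwards [self_mem_nhdsWithin] with y hy
        refine hmain _ ?_
        rw [inner_add_left, real_inner_smul_left, hu, hee, zero_add, mul_one]
        exact hy
      have c1 : Continuous fun y : ℝ => F (u + y • e) := by fun_prop
      have c2 : Continuous fun y : ℝ => (‖u + y • e‖ : ℂ) ^ 2 * G (u + y • e) := by fun_prop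
      have t1 := (c1.tendsto 0).mono_left (nhdsWithin_le_nhds (s := {0}ᶜ))
      have t2 := (c2.tendsto 0).mono_left (nhdsWithin_le_nhds (s := {0}ᶜ))
      have := tendsto_nhds_unique (t1.congr' hev) t2
      simpa using this
    · exact hmain u hu
  refine ⟨G, hGtype, fun u v huv => ?_, hall⟩
  by_cases hu : u = 0
  · have hv : v = 0 := by rw [← norm_eq_zero, ← huv, hu, norm_zero]
    rw [hu, hv]
  · have h1 := hrad u v huv
    rw [hall u, hall v, ← huv] at h1
    have : (‖u‖ : ℂ) ^ 2 ≠ 0 := pow_ne_zero 2 (by simpa using hu)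
    exact mul_left_cancel₀ this h1

/-- If division by `‖u‖²` never ended in a quotient non-zero at the origin, `F` would vanish there
to infinite order along the line through `u₀`, hence at `u₀`. -/
lemma HasExpType.exists_eq_norm_pow_mul [Nontrivial V] {r : ℝ} {F : V → ℂ}
    (h : HasExpType (Metric.closedBall 0 r) F) (hrad : ∀ u v, ‖u‖ = ‖v‖ → F u = F v)
    {u₀ : V} (hu₀ : F u₀ ≠ 0) : ∃ (n : ℕ) (H : V → ℂ), HasExpType (Metric.closedBall 0 r) H ∧
      H 0 ≠ 0 ∧ ∀ u, F u = (‖u‖ : ℂ) ^ (2 * n) * H u := by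
  by_contra hcon
  push Not at hcon
  have key : ∀ n : ℕ, ∃ H : V → ℂ, HasExpType (Metric.closedBall 0 r) H ∧
      (∀ u v, ‖u‖ = ‖v‖ → H u = H v) ∧ ∀ u, F u = (‖u‖ : ℂ) ^ (2 * n) * H u := by
    intro n
    induction n with
    | zero => exact ⟨F, h, hrad, by simp⟩
    | succ n ih =>
      obtain ⟨H, h1, h2, h3⟩ := ih
      have h4 : H 0 = 0 := by
        by_contra h5
        obtain ⟨u, hu⟩ := hcon n H h1 h5
        exact hu (h3 u)
      obtain ⟨G, g1, g2, g3⟩ := h1.exists_eq_norm_sq_mul h2 h4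
      exact ⟨G, g1, g2, fun u => by rw [h3, g3]; ring⟩
  refine hu₀ (h.eq_zero_of_isBigO Metric.isBounded_closedBall u₀ fun n => ?_)
  obtain ⟨H, h1, -, h3⟩ := key n
  obtain ⟨A, hA⟩ := h1.exists_bound
  refine Asymptotics.IsBigO.of_bound (‖u₀‖ ^ (2 * n) * A) ?_
  have : ∀ᶠ x : ℝ in 𝓝 0, |x| < 1 := by
    have : Continuous fun x : ℝ => |x| := by fun_prop
    exact this.continuousAt.eventually_lt_const (by simp)
  filter_upwards [this] with x hx
  rw [h3, norm_mul, norm_pow, Complex.norm_real, norm_norm, norm_smul, norm_pow, Real.norm_eq_abs,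
    mul_pow]
  have h5 : |x| ^ (2 * n) ≤ |x| ^ n := pow_le_pow_of_le_one (abs_nonneg _) hx.le (by omega)
  calc |x| ^ (2 * n) * ‖u₀‖ ^ (2 * n) * ‖H (x • u₀)‖ ≤ |x| ^ n * ‖u₀‖ ^ (2 * n) * A := by
        gcongr; exact hA _
    _ = _ := by ring

end Radial

end Rigidity

namespace Rigidity

/-! ### Weighted integrability near and far from the zeros; the isotropic case. -/

variable {d : ℕ}

lemma norm_diffMultiplier_sq_le (k : Fin d → ℕ) (h : ℝ) (u : E d) :
    ‖diffMultiplier k h u‖ ^ 2 ≤ (∏ j, |h| ^ (2 * k j)) * monomial (fun j => 2 * k j) u := by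
  rw [diffMultiplier, norm_prod, ← Finset.prod_pow, monomial, ← Finset.prod_mul_distrib]
  refine Finset.prod_le_prod (fun j _ => by positivity) fun j _ => ?_
  have h1 : u j ^ (2 * k j) = |u j| ^ (2 * k j) := by rw [pow_mul, pow_mul, sq_abs]
  rw [norm_pow, ← pow_mul, mul_comm (k j) 2, h1, ← mul_pow]
  gcongr
  exact norm_wave_single_sub_one_le h u j

/-- Square integrability of `q * H` for the weight `1 / s`, where `q` is controlled by `m` on `Z` and
`q * H` is controlled by `F` outside of `Z`. -/
lemma lintegral_mul_sq_div_lt_top {X : Type*} [MeasurableSpace X] {μ : Measure X} {Z : Set X}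
    (hZ : MeasurableSet Z) {s : X → ℝ≥0} {q H F : X → ℂ} {m : X → ℝ} {A c c' : ℝ} (hc : 0 ≤ c)
    (hA : ∀ x, ‖H x‖ ≤ A) (hq : ∀ x, ‖q x‖ ^ 2 ≤ c * m x)
    (hm : ∫⁻ x in Z, ENNReal.ofReal (m x) / (s x : ℝ≥0∞) ∂μ < ∞)
    (hqF : ∀ x ∈ Zᶜ, ‖q x * H x‖ ≤ c' * ‖F x‖)
    (hF : ∫⁻ x, ‖F x‖ₑ ^ 2 / (s x : ℝ≥0∞) ∂μ < ∞) :
    ∫⁻ x, ‖q x * H x‖ₑ ^ 2 / (s x : ℝ≥0∞) ∂μ < ∞ := by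
  rw [← lintegral_add_compl _ hZ, ENNReal.add_lt_top]
  constructor
  · have hle : ∀ x, ‖q x * H x‖ₑ ^ 2 / (s x : ℝ≥0∞) ≤
        ENNReal.ofReal (c * A ^ 2) * (ENNReal.ofReal (m x) / (s x : ℝ≥0∞)) := by
      intro x
      rw [← mul_div_assoc, ← ENNReal.ofReal_mul (by positivity), ← ofReal_norm,
        ← ENNReal.ofReal_pow (norm_nonneg _), norm_mul, mul_pow]
      refine ENNReal.div_le_div_right (ENNReal.ofReal_le_ofReal ?_) _
      calc _ ≤ (c * m x) * A ^ 2 := by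
            gcongr
            · exact (sq_nonneg _).trans (hq x)
            · exact hq x
            · exact hA x
        _ = _ := by ring
    refine (lintegral_mono hle).trans_lt ?_
    rw [lintegral_const_mul' _ _ ENNReal.ofReal_ne_top]
    exact ENNReal.mul_lt_top ENNReal.ofReal_lt_top hm
  · have hle : ∀ x ∈ Zᶜ, ‖q x * H x‖ₑ ^ 2 / (s x : ℝ≥0∞) ≤
        ENNReal.ofReal (c' ^ 2) * (‖F x‖ₑ ^ 2 / (s x : ℝ≥0∞)) := by
      intro x hx
      rw [← mul_div_assoc, ← ofReal_norm, ← ofReal_norm, ← ENNReal.ofReal_pow (norm_nonneg _),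
        ← ENNReal.ofReal_pow (norm_nonneg _), ← ENNReal.ofReal_mul (sq_nonneg _), ← mul_pow]
      gcongr
      exact hqF x hx
    refine (setLIntegral_mono' hZ.compl hle).trans_lt ?_
    rw [lintegral_const_mul' _ _ ENNReal.ofReal_ne_top]
    exact ENNReal.mul_lt_top ENNReal.ofReal_lt_top ((setLIntegral_le_lintegral _ _).trans_lt hF)

lemma norm_le_div_pow_mul {V : Type*} [NormedAddCommGroup V] {F H : V → ℂ} {n : ℕ}
    (hFH : ∀ u, ‖F u‖ = ‖u‖ ^ n * ‖H u‖) {ε : ℝ} (hε : 0 < ε) {u : V} (hu : ε ≤ ‖u‖) :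
    ‖H u‖ ≤ (ε ^ n)⁻¹ * ‖F u‖ := by
  rw [hFH, ← mul_assoc, inv_mul_eq_div]
  refine le_mul_of_one_le_left (norm_nonneg _) ?_
  rw [one_le_div (by positivity)]
  gcongr

/-- The margin `η` is spent in quarters: mollification, modulation before averaging, and the margin
`ρ` for the finite difference. The modulation keeps `|F|`, hence the integrability. Inside the ball
of radius `ε` the hypothesis on `k` is used; outside it, `H` is bounded by a constant times the
rotation average. -/
lemma RandomMeasure.not_linearlyRigidOfOrder_of_isIsotropic {Ω : Type*} [MeasurableSpace Ω]
    {P : Measure Ω} {M : RandomMeasure d P} [IsProbabilityMeasure P] [NeZero d]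
    (hM : M.IsWideSenseStationary) {s : E d → ℝ≥0} (hs : M.IsSpectralDensity s)
    (hiso : IsIsotropic s) {R : ℝ} (hR : 0 < R)
    (hmax : ¬ M.LinearlyMaximallyRigid (Metric.closedBall 0 R)) {k : Fin d → ℕ} {ε : ℝ} (hε : 0 < ε)
    (hk : ∫⁻ u in Metric.ball (0 : E d) ε,
      ENNReal.ofReal (monomial (fun i => 2 * k i) u) / (s u : ℝ≥0∞) < ∞) {η : ℝ} (hη : 0 < η) :
    ¬ M.LinearlyRigidOfOrder k (Metric.thickening η (Metric.closedBall 0 R)) := by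
  obtain ⟨F, hF, ⟨u₀, hu₀⟩, hFs⟩ := exists_expType_of_not_linearlyMaximallyRigid hM hs hmax
    (B := Metric.closedBall 0 (R + η / 4)) measurableSet_closedBall Metric.isBounded_closedBall
    (Metric.mem_closedBall_self (by positivity)) (δ := η / 4) (by positivity) (fun a ha t ht => by
      rw [mem_closedBall_zero_iff] at ha ⊢
      have : ‖t‖ ≤ ‖t + a‖ + ‖a‖ := by simpa using norm_sub_le (t + a) a
      linarith)
  obtain ⟨y, hy, hne⟩ := exists_rotAverage_ne_zero hF hu₀ (ε := η / 4) (by positivity)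
  have hF' : HasExpType (Metric.closedBall 0 (R + η / 2)) fun v => wave v y * F v :=
    hF.wave_mul y fun t ht => by
      rw [mem_closedBall_zero_iff] at ht ⊢
      have := norm_add_le t y
      linarith
  have hfin : ∫⁻ u, ‖wave u y * F u‖ₑ ^ 2 / (s u : ℝ≥0∞) < ∞ := by
    have : ∀ u, ‖wave u y * F u‖ₑ = ‖F u‖ₑ := fun u => by
      rw [← ofReal_norm, ← ofReal_norm, norm_mul, norm_wave, one_mul]
    simpa only [this] using hFs
  obtain ⟨n, H, hH, hH0, hFH⟩ := hF'.rotAverage.exists_eq_norm_pow_mul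
    (fun u v huv => rotAverage_eq_of_norm_eq _ huv) hne
  obtain ⟨A, hA⟩ := hH.exists_bound
  refine not_linearlyRigidOfOrder hM hs Metric.isOpen_thickening.measurableSet
    (Metric.isBounded_closedBall.thickening) (ρ := η / 4) (by positivity) (fun t ht x hx => ?_) hH
    hH0 k fun h =>
      lintegral_mul_sq_div_lt_top measurableSet_ball (c := ∏ j, |h| ^ (2 * k j))
        (c' := (∏ j, (2 : ℝ) ^ k j) * (ε ^ (2 * n))⁻¹) (by positivity) hA
        (norm_diffMultiplier_sq_le k h) hk (fun u hu => ?_)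
        (lintegral_rotAverage_lt_top hF'.continuous hs.1 hiso hfin)
  swap
  · rw [norm_mul, mul_assoc]
    gcongr
    · exact norm_diffMultiplier_le k h u
    · exact norm_le_div_pow_mul (fun u => by simp [hFH]) hε (by simpa using hu)
  rw [thickening_closedBall hη hR.le, mem_ball_zero_iff]
  rw [mem_closedBall_zero_iff] at ht
  have := norm_add_le x t
  linarith

end Rigidity

namespace Rigidity

/-! ### Tools for the separable case: division on the line, cubes, slices and products. -/

/-- On the line, a function of exponential type which vanishes at the origin is divisible by `x`. -/
lemma HasExpType.exists_eq_mul {r : ℝ} (hr : 0 ≤ r) {F : ℝ → ℂ}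
    (h : HasExpType (Set.Icc (-r) r) F) (h0 : F 0 = 0) :
    ∃ G : ℝ → ℂ, HasExpType (Set.Icc (-r) r) G ∧ ∀ x : ℝ, F x = x * G x := by
  obtain ⟨X, _, μ, T, b, hμ, hT, hb, ⟨C, hC⟩, hTB, hF⟩ := h
  have hTr : ∀ x, ‖T x‖ ≤ r := fun x => by
    rw [Real.norm_eq_abs]; exact abs_le.2 (hTB x)
  set a : X → ℂ := fun x => -(Complex.I * (inner ℝ (1 : ℝ) (T x) : ℝ)) with ha
  have ham : Measurable a := by
    have : Measurable fun x => (inner ℝ (1 : ℝ) (T x) : ℝ) := by fun_prop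
    fun_prop
  have hab : ∀ x, ‖a x * b x‖ ≤ r * C := fun x => by
    rw [norm_mul]
    refine mul_le_mul ?_ (hC x) (norm_nonneg _) hr
    simpa [ha] using hTr x
  set D : ℝ → ℂ := fun v => ∫ x, wave v (T x) * (a x * b x) ∂μ with hD
  have hDc : Continuous D := HasExpType.continuous (B := Set.Icc (-r) r)
    ⟨X, _, μ, T, fun x => a x * b x, hμ, hT, by fun_prop, ⟨_, hab⟩, hTB, fun _ => rfl⟩
  have hderiv : ∀ y, HasDerivAt F (D y) y := by
    intro y
    have := hasDerivAt_integral_wave_line (μ := μ) hT hb hTr hC 0 1 y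
    simpa only [zero_add, smul_eq_mul, mul_one, ← hF] using this
  -- Hadamard's formula `F u = u ∫₀¹ F'(τ u) dτ`; the dilation by `τ` shrinks the carrying interval.
  set G : ℝ → ℂ := fun u => ∫ τ in (0 : ℝ)..1, D (τ * u) with hG
  refine ⟨G, ?_, fun u => ?_⟩
  · set ι : Measure ℝ := volume.restrict (Set.Ioc 0 1) with hι
    have hιae : ∀ᵐ τ ∂ι, τ ∈ Set.Ioc (0 : ℝ) 1 := ae_restrict_mem measurableSet_Ioc
    have hfst : ∀ᵐ z ∂(ι.prod μ), z.1 ∈ Set.Ioc (0 : ℝ) 1 :=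
      Measure.quasiMeasurePreserving_fst.ae hιae
    have hT' : Measurable fun z : ℝ × X => z.1 * T z.2 := by fun_prop
    have hb' : Measurable fun z : ℝ × X => a z.2 * b z.2 := by fun_prop
    refine HasExpType.of_ae (μ := ι.prod μ) measurableSet_Icc (t₀ := 0) (by simpa using hr)
      hT' hb' (Eventually.of_forall fun z => hab z.2) ?_ fun u => ?_
    · filter_upwards [hfst] with z hz
      rw [Set.mem_Icc, ← abs_le, abs_mul, abs_of_nonneg hz.1.le]
      calc z.1 * |T z.2| ≤ 1 * r := by
            gcongr
            · exact hz.2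
            · exact hTr _
        _ = r := one_mul r
    · rw [integral_prod _ (integrable_wave_mul (f := fun _ => u) (by fun_prop) hT' hb'
        fun z => hab z.2)]
      simp only [hG, hD, intervalIntegral.integral_of_le zero_le_one]
      congr 1; ext τ
      congr 1; ext x
      rw [← smul_eq_mul τ u, ← smul_eq_mul τ (T x), wave_smul_left]
  · have h1 : ∀ τ ∈ Set.uIcc (0 : ℝ) 1, HasDerivAt (fun τ : ℝ => F (τ * u))
        ((u : ℂ) * D (τ * u)) τ := by
      intro τ _
      have h2 := (hderiv (τ * u)).scomp τ ((hasDerivAt_id τ).mul_const u)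
      refine h2.congr_deriv ?_
      rw [one_mul, Complex.real_smul]
    have h3 : Continuous fun τ : ℝ => (u : ℂ) * D (τ * u) := by fun_prop
    have h7 := intervalIntegral.integral_eq_sub_of_hasDerivAt h1 (h3.intervalIntegrable 0 1)
    rw [intervalIntegral.integral_const_mul, zero_mul, h0, sub_zero, one_mul] at h7
    exact h7.symm

lemma HasExpType.exists_eq_pow_mul {r : ℝ} (hr : 0 ≤ r) {F : ℝ → ℂ}
    (h : HasExpType (Set.Icc (-r) r) F) {x₀ : ℝ} (hx₀ : F x₀ ≠ 0) :
    ∃ (n : ℕ) (H : ℝ → ℂ), HasExpType (Set.Icc (-r) r) H ∧ H 0 ≠ 0 ∧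
      ∀ x : ℝ, F x = (x : ℂ) ^ n * H x := by
  by_contra hcon
  push Not at hcon
  have key : ∀ n : ℕ, ∃ H : ℝ → ℂ, HasExpType (Set.Icc (-r) r) H ∧
      ∀ x : ℝ, F x = (x : ℂ) ^ n * H x := by
    intro n
    induction n with
    | zero => exact ⟨F, h, by simp⟩
    | succ n ih =>
      obtain ⟨H, h1, h3⟩ := ih
      have h4 : H 0 = 0 := by
        by_contra h5
        obtain ⟨u, hu⟩ := hcon n H h1 h5
        exact hu (h3 u)
      obtain ⟨G, g1, g3⟩ := h1.exists_eq_mul hr h4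
      exact ⟨G, g1, fun u => by rw [h3, g3]; ring⟩
  refine hx₀ (h.eq_zero_of_isBigO (Metric.isBounded_Icc _ _) x₀ fun n => ?_)
  obtain ⟨H, h1, h3⟩ := key n
  obtain ⟨A, hA⟩ := h1.exists_bound
  refine Asymptotics.IsBigO.of_bound (|x₀| ^ n * A) (Eventually.of_forall fun x => ?_)
  rw [h3, norm_mul, norm_pow, Complex.norm_real, norm_smul, norm_pow, Real.norm_eq_abs,
    Real.norm_eq_abs, mul_pow]
  calc |x| ^ n * |x₀| ^ n * ‖H (x • x₀)‖ ≤ |x| ^ n * |x₀| ^ n * A := by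
        gcongr; exact hA _
    _ = _ := by ring

variable {d : ℕ}

lemma norm_le_of_forall_abs_le {u : E d} {δ : ℝ} (h : ∀ i, |u i| ≤ δ) (hδ : 0 ≤ δ) :
    ‖u‖ ≤ d * δ := by
  have h1 : ‖u‖ ^ 2 ≤ (d * δ) ^ 2 := by
    rw [EuclideanSpace.norm_sq_eq]
    calc ∑ i, ‖u i‖ ^ 2 ≤ ∑ _i : Fin d, δ ^ 2 := by
          gcongr with i
          exact h i
      _ = d * δ ^ 2 := by simp
      _ ≤ (d * δ) ^ 2 := by
          rw [mul_pow]
          gcongr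
          exact_mod_cast Nat.le_self_pow two_ne_zero d
  exact le_of_sq_le_sq h1 (by positivity)

lemma measurableSet_cube (d : ℕ) (R : ℝ) : MeasurableSet (cube d R) := by
  simp only [cube, Set.ofPred_forall]
  exact MeasurableSet.iInter fun i =>
    measurableSet_Icc.preimage (by fun_prop : Measurable fun t : E d => t i)

lemma isBounded_cube (d : ℕ) {R : ℝ} (hR : 0 ≤ R) : Bornology.IsBounded (cube d R) :=
  (Metric.isBounded_closedBall (x := (0 : E d)) (r := d * R)).subset fun t ht => by
    rw [mem_closedBall_zero_iff]
    exact norm_le_of_forall_abs_le (fun i => abs_le.2 (ht i)) hR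

lemma exists_mem_cube_norm_sub_le {R δ : ℝ} (hR : 0 ≤ R) (hδ : 0 ≤ δ) {t : E d}
    (ht : t ∈ cube d (R + δ)) : ∃ t' ∈ cube d R, ‖t - t'‖ ≤ d * δ := by
  refine ⟨WithLp.toLp 2 fun i => max (-R) (min R (t i)), fun i => ?_,
    norm_le_of_forall_abs_le (fun i => ?_) hδ⟩
  · exact ⟨le_max_left _ _, max_le (by linarith) (min_le_left _ _)⟩
  · obtain ⟨h1, h2⟩ := ht i
    simp only [PiLp.sub_apply]
    rw [abs_le]
    rcases le_total R (t i) with h3 | h3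
    · rw [min_eq_left h3, max_eq_right (by linarith)]
      constructor <;> linarith
    · rw [min_eq_right h3]
      rcases le_total (-R) (t i) with h4 | h4
      · rw [max_eq_right h4]; constructor <;> linarith
      · rw [max_eq_left h4]; constructor <;> linarith

lemma wave_smul_single (x : ℝ) (i : Fin d) (t : E d) :
    wave (x • EuclideanSpace.single i (1 : ℝ)) t = wave x (t i) := by
  rw [wave, wave, real_inner_smul_left, EuclideanSpace.inner_single_left]
  simp [mul_comm]

lemma wave_single (u : E d) (j : Fin d) (h : ℝ) :
    wave u (EuclideanSpace.single j h) = wave (u j) h := by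
  rw [wave, wave, EuclideanSpace.inner_single_right]
  simp

/-- The restriction of a function of exponential type to a line parallel to an axis. -/
lemma HasExpType.slice {r : ℝ} {F : E d → ℂ} (h : HasExpType (cube d r) F) (v : E d) (i : Fin d) :
    HasExpType (Set.Icc (-r) r) fun x : ℝ => F (v + x • EuclideanSpace.single i (1 : ℝ)) := by
  obtain ⟨X, _, μ, T, b, h1, h2, h3, ⟨C, h4⟩, h5, h6⟩ := h
  refine ⟨X, inferInstance, μ, fun x => T x i, fun x => wave v (T x) * b x, h1, by fun_prop,
    by fun_prop, ⟨C, fun x => by simpa using h4 x⟩, fun x => h5 x i, fun x => ?_⟩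
  dsimp only
  rw [h6]
  congr 1; ext y
  rw [wave_add_left, wave_smul_single]; ring

/-- A product of one-variable transforms is the transform of the product measure, carried by the
product of the intervals. -/
lemma HasExpType.prod {r : ℝ} {F : Fin d → ℝ → ℂ} (h : ∀ i, HasExpType (Set.Icc (-r) r) (F i)) :
    HasExpType (cube d r) fun u => ∏ i, F i (u i) := by
  unfold HasExpType at h
  choose X mX μ T b h1 h2 h3 hC h5 h6 using h
  choose C h4 using hC
  have hT : Measurable fun x : ∀ i, X i => WithLp.toLp 2 fun i => T i (x i) := by
    have : Measurable fun x : ∀ i, X i => fun i => T i (x i) :=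
      measurable_pi_lambda _ fun i => (h2 i).comp (measurable_pi_apply i)
    fun_prop
  refine ⟨∀ i, X i, inferInstance, Measure.pi μ, fun x => WithLp.toLp 2 fun i => T i (x i),
    fun x => ∏ i, b i (x i), inferInstance, hT, ?_, ⟨∏ i, C i, fun x => ?_⟩, fun x i => h5 i _,
    fun u => ?_⟩
  · exact Finset.measurable_prod _ fun i _ => (h3 i).comp (measurable_pi_apply i)
  · rw [norm_prod]
    exact Finset.prod_le_prod (fun i _ => norm_nonneg _) fun i _ => h4 i _
  · simp only [h6]
    rw [← integral_fintype_prod_eq_prod (fun i x => wave (u i) (T i x) * b i x)]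
    congr 1; ext x
    rw [Finset.prod_mul_distrib]
    congr 1
    simp only [wave, ← Complex.exp_sum]
    congr 1
    rw [PiLp.inner_apply]
    push_cast
    rw [Finset.mul_sum, Finset.sum_neg_distrib]

lemma lintegral_fin_prod_eq_prod {n : ℕ} {f : Fin n → ℝ → ℝ≥0∞} (hf : ∀ i, Measurable (f i)) :
    ∫⁻ x : Fin n → ℝ, ∏ i, f i (x i) = ∏ i, ∫⁻ x, f i x := by
  induction n with
  | zero => simp [volume_pi]
  | succ n ih =>
    have hmp := (volume_preserving_piFinSuccAbove (fun _ : Fin (n + 1) => ℝ) 0).symm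
    rw [← hmp.lintegral_comp_emb (MeasurableEquiv.measurableEmbedding _), Fin.prod_univ_succ,
      ← ih fun i => hf _, Measure.volume_eq_prod, ← lintegral_prod_mul (hf 0).aemeasurable
        (Finset.measurable_prod _ fun i _ =>
          (hf i.succ).comp (measurable_pi_apply i)).aemeasurable]
    congr 1; ext z
    rw [Fin.prod_univ_succ]
    simp [MeasurableEquiv.piFinSuccAbove, Fin.insertNthEquiv]

lemma lintegral_euclidean_prod_eq_prod {f : Fin d → ℝ → ℝ≥0∞} (hf : ∀ i, Measurable (f i)) :
    ∫⁻ u : E d, ∏ i, f i (u i) = ∏ i, ∫⁻ x, f i x := by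
  rw [← lintegral_fin_prod_eq_prod hf, ← (PiLp.volume_preserving_ofLp (Fin d)).lintegral_comp]
  exact Finset.measurable_prod _ fun i _ => (hf i).comp (measurable_pi_apply i)

/-- Finiteness of an integral passes to the integrals along almost every line. -/
lemma exists_mem_lintegral_line_lt_top {Φ : E d → ℝ≥0∞} (hΦ : Measurable Φ)
    (hfin : ∫⁻ u, Φ u < ∞) {U : Set (E d)} (hU : IsOpen U) (hne : U.Nonempty) (i : Fin d) :
    ∃ u ∈ U, Φ u < ∞ ∧ ∫⁻ x : ℝ, Φ (u + x • EuclideanSpace.single i (1 : ℝ)) < ∞ := by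
  obtain ⟨u₀, hu₀⟩ := hne
  set e : E d := EuclideanSpace.single i (1 : ℝ) with he
  -- Integrating line integrals over the whole space would count each line infinitely often. On a
  -- slab of width `2` across the direction, Tonelli gives exactly `2 ∫ Φ`.
  set Z : Set (E d) := {u | u i ∈ Set.Ioo (u₀ i - 1) (u₀ i + 1)} with hZ
  have hZo : IsOpen Z := isOpen_Ioo.preimage (by fun_prop : Continuous fun u : E d => u i)
  have hZm := hZo.measurableSet
  have hgm : Measurable fun z : E d × ℝ => Φ (z.1 + z.2 • e) := hΦ.comp (by fun_prop)
  have key : ∫⁻ u in Z, ∫⁻ x : ℝ, Φ (u + x • e) < ∞ := by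
    have e1 : ∫⁻ u in Z, ∫⁻ x : ℝ, Φ (u + x • e) =
        ∫⁻ x : ℝ, ∫⁻ u, Z.indicator (fun u => Φ (u + x • e)) u := by
      rw [lintegral_lintegral_swap hgm.aemeasurable]
      simp only [lintegral_indicator hZm]
    have e2 : ∀ x : ℝ, ∫⁻ u, Z.indicator (fun u => Φ (u + x • e)) u =
        ∫⁻ u, {x : ℝ | u - x • e ∈ Z}.indicator (fun _ => Φ u) x := by
      intro x
      rw [← lintegral_sub_right_eq_self _ (x • e)]
      refine lintegral_congr fun u => ?_
      simp only [Set.indicator, Set.mem_ofPred_eq, sub_add_cancel]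
    have e3 : Measurable (Function.uncurry fun (x : ℝ) (u : E d) =>
        {x : ℝ | u - x • e ∈ Z}.indicator (fun _ => Φ u) x) := by
      have : (Function.uncurry fun (x : ℝ) (u : E d) =>
          {x : ℝ | u - x • e ∈ Z}.indicator (fun _ => Φ u) x) =
          ((fun z : ℝ × E d => z.2 - z.1 • e) ⁻¹' Z).indicator fun z => Φ z.2 := by
        ext z
        simp [Function.uncurry, Set.indicator]
      rw [this]
      exact (hΦ.comp measurable_snd).indicator (hZm.preimage (by fun_prop))
    have e4 : ∀ u : E d, ∫⁻ x : ℝ, {x : ℝ | u - x • e ∈ Z}.indicator (fun _ => Φ u) x =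
        Φ u * 2 := by
      intro u
      have e5 : {x : ℝ | u - x • e ∈ Z} = Set.Ioo (u i - u₀ i - 1) (u i - u₀ i + 1) := by
        ext x
        simp only [hZ, he, Set.mem_ofPred_eq, PiLp.sub_apply, PiLp.smul_apply,
          PiLp.single_apply, if_true, smul_eq_mul, mul_one, Set.mem_Ioo]
        constructor <;> rintro ⟨h1, h2⟩ <;> constructor <;> linarith
      rw [e5, lintegral_indicator measurableSet_Ioo, lintegral_const, Measure.restrict_apply_univ,
        Real.volume_Ioo]
      congr 1
      rw [show u i - u₀ i + 1 - (u i - u₀ i - 1) = 2 by ring]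
      simp
    rw [e1, lintegral_congr e2, lintegral_lintegral_swap e3.aemeasurable, lintegral_congr e4,
      lintegral_mul_const _ hΦ]
    exact ENNReal.mul_lt_top hfin (by simp)
  have hae := ae_lt_top (hgm.lintegral_prod_right') key.ne
  by_contra hcon
  push Not at hcon
  have hsub : ∀ᵐ u ∂(volume.restrict Z), u ∉ U := by
    filter_upwards [hae, ae_restrict_of_ae (ae_lt_top hΦ hfin.ne)] with u hu hu' huU
    exact absurd (hcon u huU hu') (not_le.2 hu)
  have hzero : volume (U ∩ Z) = 0 := by
    rw [ae_iff] at hsub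
    simp only [not_not, Set.ofPred_mem_eq] at hsub
    rwa [Measure.restrict_apply hU.measurableSet] at hsub
  have hpos : 0 < volume (U ∩ Z) :=
    (hU.inter hZo).measure_pos volume ⟨u₀, hu₀, by simp [hZ]⟩
  exact hpos.ne' hzero

end Rigidity

namespace Rigidity

/-! ### The separable case. -/

lemma ennreal_prod_div_coe_prod {ι : Type*} (t : Finset ι) (a : ι → ℝ≥0∞) (b : ι → ℝ≥0) :
    (∏ i ∈ t, a i) / ((∏ i ∈ t, b i : ℝ≥0) : ℝ≥0∞) = ∏ i ∈ t, a i / (b i : ℝ≥0∞) := by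
  classical
  induction t using Finset.induction_on with
  | empty => simp
  | insert i t hi ih =>
    rw [Finset.prod_insert hi, Finset.prod_insert hi, Finset.prod_insert hi, ← ih, ENNReal.coe_mul,
      div_eq_mul_inv, ENNReal.mul_inv (Or.inr ENNReal.coe_ne_top) (Or.inl ENNReal.coe_ne_top),
      div_eq_mul_inv, div_eq_mul_inv]
    ring

variable {d : ℕ}

lemma prod_add_smul_single (σ : Fin d → ℝ → ℝ≥0) (v : E d) (x : ℝ) (i : Fin d) :
    ∏ j, σ j ((v + x • EuclideanSpace.single i (1 : ℝ)) j) =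
      σ i (v i + x) * ∏ j ∈ Finset.univ.erase i, σ j (v j) := by
  rw [← Finset.mul_prod_erase _ _ (Finset.mem_univ i)]
  congr 1
  · simp
  · refine Finset.prod_congr rfl fun j hj => ?_
    simp [Finset.ne_of_mem_erase hj]

/-- For a separable weight, local integrability of `u ^ 2k / s` passes to the factors. -/
lemma setLIntegral_Icc_lt_top_of_separable [NeZero d] {k : Fin d → ℕ} {s : E d → ℝ≥0}
    {σ : Fin d → ℝ → ℝ≥0} (hσ : ∀ u, s u = ∏ i, σ i (u i)) (hσm : ∀ i, Measurable (σ i)) {ε δ : ℝ}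
    (hδ : 0 < δ) (hδε : d * δ < ε)
    (hk : ∫⁻ u in Metric.ball (0 : E d) ε,
      ENNReal.ofReal (monomial (fun i => 2 * k i) u) / (s u : ℝ≥0∞) < ∞) (i : Fin d) :
    ∫⁻ x in Set.Icc (-δ) δ, ENNReal.ofReal (x ^ (2 * k i)) / (σ i x : ℝ≥0∞) < ∞ := by
  set g : Fin d → ℝ → ℝ≥0∞ := fun j => (Set.Icc (-δ) δ).indicator
    fun x => ENNReal.ofReal (x ^ (2 * k j)) / (σ j x : ℝ≥0∞) with hg
  have hgm : ∀ j, Measurable (g j) := fun j => by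
    have := (hσm j).coe_nnreal_ennreal
    exact Measurable.indicator (by fun_prop) measurableSet_Icc
  have hprod : ∏ j, ∫⁻ x, g j x < ∞ := by
    rw [← lintegral_euclidean_prod_eq_prod hgm]
    refine lt_of_le_of_lt ?_ hk
    rw [← lintegral_indicator measurableSet_ball]
    refine lintegral_mono fun u => ?_
    by_cases hu : ∀ j, u j ∈ Set.Icc (-δ) δ
    · have hub : u ∈ Metric.ball (0 : E d) ε := by
        rw [mem_ball_zero_iff]
        exact (norm_le_of_forall_abs_le (fun j => abs_le.2 (hu j)) hδ.le).trans_lt hδε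
      rw [Set.indicator_of_mem hub, hσ, monomial,
        ENNReal.ofReal_prod_of_nonneg fun j _ => (even_two_mul (k j)).pow_nonneg _,
        ennreal_prod_div_coe_prod]
      refine le_of_eq (Finset.prod_congr rfl fun j _ => ?_)
      exact Set.indicator_of_mem (hu j) _
    · push Not at hu
      obtain ⟨j, hj⟩ := hu
      dsimp only
      rw [Finset.prod_eq_zero (Finset.mem_univ j) (Set.indicator_of_notMem hj _)]
      exact zero_le
  -- A finite product bounds one factor only if the others are non-zero; each integrand is positive
  -- on `(0, δ]` because `σ j` is finite.
  have hpos : ∀ j, ∫⁻ x, g j x ≠ 0 := by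
    intro j
    refine ((lintegral_pos_iff_support (hgm j)).2 ?_).ne'
    refine lt_of_lt_of_le ?_ (measure_mono (s := Set.Ioc 0 δ) fun x hx => ?_)
    · simpa using hδ
    · rw [Function.mem_support]
      simp only [hg]
      have hxm : x ∈ Set.Icc (-δ) δ := ⟨by linarith [hx.1], hx.2⟩
      rw [Set.indicator_of_mem hxm]
      refine (ENNReal.div_pos ?_ ENNReal.coe_ne_top).ne'
      have := pow_pos hx.1 (2 * k j)
      simpa using this
  rw [← lintegral_indicator measurableSet_Icc]
  by_contra htop
  rw [not_lt, top_le_iff] at htop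
  rw [← Finset.mul_prod_erase _ _ (Finset.mem_univ i)] at hprod
  have htop' : ∫⁻ x, g i x = ∞ := htop
  rw [htop', ENNReal.top_mul (Finset.prod_ne_zero_iff.2 fun j _ => hpos j)] at hprod
  exact lt_irrefl _ hprod

/-- On a line parallel to the `i`-th axis, `s` is a constant times `σ i`. Through a good point the
constant is non-zero, so the slice of `F` is square integrable for `1 / σ i`. Removing the zero at
the origin of each slice and multiplying the quotients reduces the weighted integral to a product of
one-dimensional ones. -/
lemma RandomMeasure.not_linearlyRigidOfOrder_of_isSeparable {Ω : Type*} [MeasurableSpace Ω]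
    {P : Measure Ω} {M : RandomMeasure d P} [IsProbabilityMeasure P] [NeZero d]
    (hM : M.IsWideSenseStationary) {s : E d → ℝ≥0} (hs : M.IsSpectralDensity s)
    (hsep : IsSeparable s) {R : ℝ} (hR : 0 < R)
    (hmax : ¬ M.LinearlyMaximallyRigid (cube d R)) {k : Fin d → ℕ} {ε : ℝ} (hε : 0 < ε)
    (hk : ∫⁻ u in Metric.ball (0 : E d) ε,
      ENNReal.ofReal (monomial (fun i => 2 * k i) u) / (s u : ℝ≥0∞) < ∞) {η : ℝ} (hη : 0 < η) :
    ¬ M.LinearlyRigidOfOrder k (Metric.thickening η (cube d R)) := by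
  obtain ⟨σ, -, hσ⟩ := hsep
  have hd : (0 : ℝ) < d := by exact_mod_cast NeZero.pos d
  -- Enlarging every side by `κ` moves points by at most `d κ = η / 4`; another `η / 4` is kept for
  -- the finite difference.
  set κ : ℝ := η / (4 * d) with hκ
  have hκ0 : 0 < κ := by positivity
  have hdκ : d * κ = η / 4 := by rw [hκ]; field_simp
  obtain ⟨F, hF, ⟨u₀, hu₀⟩, hFs⟩ := exists_expType_of_not_linearlyMaximallyRigid hM hs hmax
    (B := cube d (R + κ)) (measurableSet_cube d _) (isBounded_cube d (by positivity))
    (fun i => ⟨by simpa using by linarith, by simpa using by linarith⟩) hκ0 (fun a ha t ht i => by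
      have h1 := (abs_le.1 ((PiLp.norm_apply_le (t + a) i).trans ht))
      have h2 := ha i
      simp only [PiLp.add_apply] at h1
      exact ⟨by linarith [h1.1, h2.2], by linarith [h1.2, h2.1]⟩)
  have hFc := hF.continuous
  have hsm := hs.1
  set Φ : E d → ℝ≥0∞ := fun u => ‖F u‖ₑ ^ 2 / (s u : ℝ≥0∞) with hΦ
  have hΦm : Measurable Φ := by
    have h1 := hFc.measurable
    have h2 := hsm.coe_nnreal_ennreal
    fun_prop
  have hUo : IsOpen {u | F u ≠ 0} := isOpen_ne_fun hFc continuous_const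
  choose w hwU hwΦ hwfin using fun i => exists_mem_lintegral_line_lt_top hΦm hFs hUo ⟨u₀, hu₀⟩ i
  -- `Φ (w i)` is finite although `F (w i) ≠ 0`.
  have hsw : ∀ i, s (w i) ≠ 0 := by
    intro i h0
    have := hwΦ i
    simp only [hΦ, h0, ENNReal.coe_zero] at this
    rw [ENNReal.div_zero (by simpa using hwU i)] at this
    exact lt_irrefl _ this
  have hc0 : ∀ i, ∏ j ∈ Finset.univ.erase i, σ j (w i j) ≠ 0 := by
    intro i h0
    apply hsw i
    rw [hσ, ← Finset.mul_prod_erase _ _ (Finset.mem_univ i), h0, mul_zero]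
  -- Separability does not include measurable factors; they are recovered from `s` along a line
  -- where the remaining product is non-zero.
  have hσm : ∀ i, Measurable (σ i) := by
    intro i
    have h1 : σ i = fun x => s (w i + (x - w i i) • EuclideanSpace.single i (1 : ℝ)) /
        ∏ j ∈ Finset.univ.erase i, σ j (w i j) := by
      ext1 x
      rw [hσ, prod_add_smul_single, add_sub_cancel, mul_div_cancel_right₀ _ (hc0 i)]
    rw [h1]
    exact (hsm.comp (by fun_prop)).div_const _
  -- The base point has `i`-th coordinate `0`, so the line parameter is the coordinate itself and
  -- matches the argument of `σ i`.
  set v : Fin d → E d := fun i => w i + (-(w i i)) • EuclideanSpace.single i (1 : ℝ) with hv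
  have hvadd : ∀ i (x : ℝ), v i + (w i i + x) • EuclideanSpace.single i (1 : ℝ) =
      w i + x • EuclideanSpace.single i (1 : ℝ) := by
    intro i x
    rw [hv]
    module
  set f : Fin d → ℝ → ℂ := fun i x => F (v i + x • EuclideanSpace.single i (1 : ℝ)) with hf
  have hfσ : ∀ i, ∫⁻ x, ‖f i x‖ₑ ^ 2 / (σ i x : ℝ≥0∞) < ∞ := by
    intro i
    set c : ℝ≥0 := ∏ j ∈ Finset.univ.erase i, σ j (w i j) with hc
    have h1 : ∀ x : ℝ, ‖f i (w i i + x)‖ₑ ^ 2 / (σ i (w i i + x) : ℝ≥0∞) =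
        c * Φ (w i + x • EuclideanSpace.single i (1 : ℝ)) := by
      intro x
      have hcc : (c : ℝ≥0∞) ≠ 0 := by exact_mod_cast hc0 i
      simp only [hΦ, hf]
      rw [hvadd, hσ, prod_add_smul_single, ← hc, ENNReal.coe_mul, mul_comm (σ i _ : ℝ≥0∞),
        ← mul_div_assoc, ENNReal.mul_div_mul_left _ _ hcc ENNReal.coe_ne_top]
    rw [← lintegral_add_left_eq_self _ (w i i), lintegral_congr h1,
      lintegral_const_mul' _ _ ENNReal.coe_ne_top]
    exact ENNReal.mul_lt_top ENNReal.coe_lt_top (hwfin i)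
  have hfne : ∀ i, f i (w i i) ≠ 0 := by
    intro i
    have := hvadd i 0
    rw [add_zero, zero_smul, add_zero] at this
    simp only [hf]
    rw [this]
    exact hwU i
  choose n H hH hH0 hfH using fun i =>
    (hF.slice (v i) i).exists_eq_pow_mul (by positivity) (hfne i)
  choose C hC using fun i => (hH i).exists_bound
  -- The cube of half-side `δ` lies in the ball of radius `ε`, since `d δ = ε / 2`.
  set δ : ℝ := ε / (2 * d) with hδ
  have hδ0 : 0 < δ := by positivity
  have hdδ : d * δ < ε := by
    have : d * δ = ε / 2 := by rw [hδ]; field_simp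
    linarith
  refine not_linearlyRigidOfOrder hM hs Metric.isOpen_thickening.measurableSet
    (isBounded_cube d hR.le).thickening (ρ := η / 4) (by positivity) (fun t ht x hx => ?_)
    (HasExpType.prod hH) ?_ k fun h => ?_
  · obtain ⟨t', ht', htt⟩ := exists_mem_cube_norm_sub_le hR.le hκ0.le ht
    rw [Metric.mem_thickening_iff]
    refine ⟨t', ht', ?_⟩
    rw [dist_eq_norm, add_sub_assoc]
    have := norm_add_le x (t - t')
    linarith
  · exact Finset.prod_ne_zero_iff.2 fun i _ => hH0 i
  · have h1 : ∀ u : E d, ‖diffMultiplier k h u * ∏ i, H i (u i)‖ₑ ^ 2 / (s u : ℝ≥0∞) =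
        ∏ i, ‖(wave (u i) h - 1) ^ k i * H i (u i)‖ₑ ^ 2 / (σ i (u i) : ℝ≥0∞) := by
      intro u
      rw [diffMultiplier, ← Finset.prod_mul_distrib, ← ennreal_prod_div_coe_prod, ← hσ,
        Finset.prod_pow]
      simp only [wave_single]
      congr 2
      simp only [← ofReal_norm, norm_prod]
      rw [ENNReal.ofReal_prod_of_nonneg fun i _ => norm_nonneg _]
    rw [lintegral_congr h1, lintegral_euclidean_prod_eq_prod
      (f := fun i x => ‖(wave x h - 1) ^ k i * H i x‖ₑ ^ 2 / (σ i x : ℝ≥0∞)) fun i => ?_]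
    · refine ENNReal.prod_lt_top fun i _ => ?_
      refine lintegral_mul_sq_div_lt_top measurableSet_Icc (c := |h| ^ (2 * k i))
        (c' := 2 ^ k i * (δ ^ n i)⁻¹) (by positivity) (hC i) (fun x => ?_)
        (setLIntegral_Icc_lt_top_of_separable hσ hσm hδ0 hdδ hk i) (fun x hx => ?_) (hfσ i)
      · have h2 := (norm_wave_sub_one_le x h).trans (norm_inner_le_norm x h)
        have h3 : x ^ (2 * k i) = |x| ^ (2 * k i) := by rw [pow_mul, pow_mul, sq_abs]
        rw [norm_pow, ← pow_mul, mul_comm (k i) 2, h3, ← mul_pow, mul_comm |h|]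
        gcongr
        exact h2
      · rw [norm_mul, mul_assoc, norm_pow]
        have h2 : ‖wave x h - 1‖ ≤ 2 := by
          refine (norm_sub_le _ _).trans ?_
          rw [norm_wave, norm_one]; norm_num
        have h3 : δ ≤ ‖x‖ := by
          rw [Real.norm_eq_abs]
          by_contra hlt
          exact hx (abs_le.1 (not_le.1 hlt).le)
        have h4 := norm_le_div_pow_mul (F := f i) (H := H i) (n := n i)
          (fun u => by simp [hf, hfH i u]) hδ0 h3
        gcongr
    · have h2 := (hσm i).coe_nnreal_ennreal
      have h3 := (hH i).continuous.measurable
      fun_prop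

/-- Here `D` is the whole one-point space, so all approximants are zero and `I(1) = 0` almost
surely. By linearity every statistic vanishes, and zero approximants give maximal rigidity. -/
lemma RandomMeasure.linearlyMaximallyRigid_of_dim_zero {Ω : Type*} [MeasurableSpace Ω]
    {P : Measure Ω} {M : RandomMeasure 0 P} {k : Fin 0 → ℕ} {D : Set (E 0)} (hD : 0 ∈ D)
    (h : M.LinearlyRigidOfOrder k D) (A : Set (E 0)) : M.LinearlyMaximallyRigid A := by
  obtain ⟨f, hf, hlim, -⟩ := h
  have hDu : D = Set.univ := Set.eq_univ_of_forall fun x => by rwa [Subsingleton.elim x 0]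
  have hf0 : ∀ n, f n = 0 := by
    intro n
    have h1 : tsupport (f n) = ∅ := by
      rw [← Set.subset_empty_iff]
      simpa [hDu] using (hf n).tsupport_subset
    exact tsupport_eq_empty_iff.1 h1
  have hzero : ∀ᵐ ω ∂P, M.I 0 ω = 0 := by
    have := M.smul 0 0 IsCcb.zero
    simpa using this
  set γ₁ : E 0 → ℝ := D.indicator (monomial k) with hγ₁
  have hγ₁1 : γ₁ = fun _ => 1 := by
    ext x
    simp [hγ₁, hDu, monomial]
  have hγ₁0 : ∀ᵐ ω ∂P, M.I γ₁ ω = 0 := by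
    filter_upwards [hlim, hzero] with ω h1 h2
    simp only [hf0, h2] at h1
    exact tendsto_nhds_unique h1 tendsto_const_nhds
  have hγ₁c : IsCcb Set.univ γ₁ :=
    isCcb_of_continuous (by rw [hγ₁1]; fun_prop) (HasCompactSupport.of_compactSpace _)
  intro γ _
  have hγ0 : ∀ᵐ ω ∂P, M.I γ ω = 0 := by
    have h1 : γ = γ 0 • γ₁ := by
      ext x
      rw [Subsingleton.elim x 0, hγ₁1]
      simp
    filter_upwards [M.smul (γ 0) γ₁ hγ₁c, hγ₁0] with ω h2 h3
    rw [h1, h2, h3, mul_zero]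
  refine ⟨fun _ => 0, fun _ => IsCcb.zero, ?_, ?_⟩
  · filter_upwards [hγ0, hzero] with ω h1 h2
    rw [h1, h2]
    exact tendsto_const_nhds
  · have : M.I 0 - M.I γ =ᵐ[P] 0 := by
      filter_upwards [hγ0, hzero] with ω h1 h2
      simp [h1, h2]
    have h0 : eLpNorm (M.I 0 - M.I γ) 2 P = 0 := by rw [eLpNorm_congr_ae this, eLpNorm_zero]
    exact tendsto_const_nhds.congr fun _ => h0.symm

end Rigidity

theorem theorem3p8 {d : ℕ} {Ω : Type*} [MeasurableSpace Ω] (P : Measure Ω)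
    [IsProbabilityMeasure P] (M : Rigidity.RandomMeasure d P) (hM : M.IsWideSenseStationary)
    (s : Rigidity.E d → ℝ≥0) (hs : M.IsSpectralDensity s)
    (R : ℝ) (hR : 0 < R) (A : Set (Rigidity.E d))
    (hA : (Rigidity.IsIsotropic s ∧ A = Metric.closedBall 0 R) ∨
      (Rigidity.IsSeparable s ∧ A = Rigidity.cube d R))
    (hmax : ¬ M.LinearlyMaximallyRigid A)
    (k : Fin d → ℕ)
    (hk : ∃ ε : ℝ, 0 < ε ∧ ∫⁻ u in Metric.ball (0 : Rigidity.E d) ε,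
      ENNReal.ofReal (Rigidity.monomial (fun i => 2 * k i) u) / (s u : ℝ≥0∞) < ∞)
    (η : ℝ) (hη : 0 < η) :
    ¬ M.LinearlyRigidOfOrder k (Metric.thickening η A) := by
  obtain ⟨ε, hε, hk⟩ := hk
  -- Dimension zero is separate because the atom at the origin of the moment measure is not singular
  -- there.
  rcases Nat.eq_zero_or_pos d with rfl | hd
  · intro hrig
    refine hmax (Rigidity.RandomMeasure.linearlyMaximallyRigid_of_dim_zero ?_ hrig A)
    refine Metric.self_subset_thickening hη A ?_
    rcases hA with ⟨-, rfl⟩ | ⟨-, rfl⟩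
    · exact Metric.mem_closedBall_self hR.le
    · exact fun i => i.elim0
  · have : NeZero d := ⟨hd.ne'⟩
    rcases hA with ⟨hiso, rfl⟩ | ⟨hsep, rfl⟩
    · exact Rigidity.RandomMeasure.not_linearlyRigidOfOrder_of_isIsotropic hM hs hiso hR hmax hε hk
        hη
    · exact Rigidity.RandomMeasure.not_linearlyRigidOfOrder_of_isSeparable hM hs hsep hR hmax hε hk
        hη
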